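/- Let $\mathbb K$ be a field, and let $\mathcal T=(T_{\mathsf L}\to T\leftarrow T_{\mathsf R})$ be the regular front projection of a bordered Legendrian graph in $J^1[x_{\mathsf L},x_{\mathsf R}]$ (with finitely many vertices, of arbitrary types $(\ell,r)$ with $\ell+r\ge 1$, and finitely many base points), with left border $T_{\mathsf L}=\{1,\dots,n_{\mathsf L}\}$ and right border $T_{\mathsf R}=\{1,\dots,n_{\mathsf R}\}$, labelled from top to bottom. Let $\mu$ be a $\mathbb Z$-valued Maslov potential on $T$ (constant along strands away from vertices and cusps, with upper minus lower value $1$ at each cusp, and no condition at vertices), and let $\mu_{\mathsf L},\mu_{\mathsf R}$ be its restrictions to the borders. For $\nu:\{1,\dots,n\}\to\mathbb Z$ let $A_n(\nu)$ be the border DGA: the free graded ring $\mathbb Z\langle k_{ab}\mid 1\le a<b\le n\rangle$ with $|k_{ab}|=\nu(a)-\nu(b)-1$ and $\partial k_{ab}=\sum_{a<c<b}(-1)^{|k_{ac}|-1}k_{ac}k_{cb}$. Let $$A_{n_{\mathsf L}}(\mu_{\mathsf L})\xrightarrow{\ \phi_{\mathsf L}\ }A^{\mathsf{CE}}(T,\mu)\xleftarrow{\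 \phi_{\mathsf R}\ }A_{n_{\mathsf R}}(\mu_{\mathsf R})$$ be the bordered Chekanov–Eliashberg DGA of $(\mathcal T,\mu)$. Here $A^{\mathsf{CE}}(T,\mu)$ is the free graded algebra over $\mathbb Z[t_b^{\pm1}\mid b\text{ a base point}]$ (in degree $0$, $\partial t_b=0$) generated by the left border generators $k_{ab}$, the crossings $c$ of Ng's resolution of $T$, and the spirals $v_{a,i}$ ($a\in\mathbb Z/\mathrm{val}(v)$, $i\ge1$) around the vertices $v$. Its differential is that of $A_{n_{\mathsf L}}(\mu_{\mathsf L})$ on the $k_{ab}$; it is $$\partial v_{a,i}=\delta_{i,\mathrm{val}(v)}+\sum_{i_1+i_2=i}(-1)^{|v_{a,i_1}|-1}v_{a,i_1}v_{a+i_1,i_2}$$ on the spirals, and the signed count of immersed polygons with a positive corner at $c$ on a crossing $c$, where the polygons may also end on the left border. The map $\phi_{\mathsf L}$ is the inclusion, and $\phi_{\mathsf R}(k_{ab})$ is the signed count of immersed half-disks in the resolution bounded on the right by the segment of the right border between the strands $a$ and $b$. An augmentation of a DGA $A$ over $\mathbb K$ is a DGA morphism $\epsilon:A\to\mathbb K$,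 where $\mathbb K$ lies in degree $0$ and has zero differential. An augmentation $\epsilon$ of $A_n(\nu)$ defines the cochain complex (Morse complex) with basis $e_1,\dots,e_n$, $|e_a|=-\nu(a)$, and differential $d(e_a)=\sum_{a<b}(-1)^{\nu(a)}\epsilon(k_{ab})e_b$; $\epsilon$ is called acyclic if the cohomology of this complex vanishes. **Claim.** Let $\epsilon:A^{\mathsf{CE}}(T,\mu)\to\mathbb K$ be an augmentation. If the augmentation $\epsilon_{\mathsf L}=\epsilon\circ\phi_{\mathsf L}$ of $A_{n_{\mathsf L}}(\mu_{\mathsf L})$ is acyclic, then $\epsilon_{\mathsf R}=\epsilon\circ\phi_{\mathsf R}$ is an acyclic augmentation of $A_{n_{\mathsf R}}(\mu_{\mathsf R})$. -/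

import Mathlib

open Matrix

namespace LegendrianGraph

/-!
### Semifree differential graded algebras
-/

/-- The Laurent polynomial ring `ℤ[t_b, t_b⁻¹ | b ∈ B]`. -/
abbrev Laurent (B : Type) : Type := AddMonoidAlgebra ℤ (B →₀ ℤ)

/-- The variable `t_b`, as a unit of the Laurent polynomial ring. -/
noncomputable def Laurent.t {B : Type} (b : B) : (Laurent B)ˣ :=
  Units.map (AddMonoidAlgebra.of ℤ (B →₀ ℤ))
    (toUnits (Multiplicative.ofAdd (Finsupp.single b (1 : ℤ))))

section Differential

variable {R : Type} [CommRing R] {X : Type}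

/-- The algebra map `a ↦ ((-1)^|a| a, ∂a; 0, a)` into upper triangular `2 × 2` matrices that is
prescribed on the free generators.  Its multiplicativity is the graded Leibniz rule. -/
noncomputable def leibnizHom (deg : X → ℤ) (d : X → FreeAlgebra R X) :
    FreeAlgebra R X →ₐ[R] Matrix (Fin 2) (Fin 2) (FreeAlgebra R X) :=
  FreeAlgebra.lift R fun x =>
    !![(deg x).negOnePow • FreeAlgebra.ι R x, d x; 0, FreeAlgebra.ι R x]

/-- The parity automorphism `a ↦ (-1)^|a| a` of the graded free algebra `R⟨X⟩`. -/
noncomputable def parity (deg : X → ℤ) : FreeAlgebra R X →ₐ[R] FreeAlgebra R X :=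
  FreeAlgebra.lift R fun x => (deg x).negOnePow • FreeAlgebra.ι R x

/-- The `R`-linear differential `∂` on the graded free algebra `R⟨X⟩` that has the prescribed
values on the free generators and satisfies the graded Leibniz rule
`∂(ab) = (∂a) b + (-1)^|a| a (∂b)`. -/
noncomputable def differential (deg : X → ℤ) (d : X → FreeAlgebra R X) :
    FreeAlgebra R X →ₗ[R] FreeAlgebra R X where
  toFun a := leibnizHom deg d a 0 1
  map_add' a b := by simp
  map_smul' r a := by simp

theorem differential_ι (deg : X → ℤ) (d : X → FreeAlgebra R X) (x : X) :
    differential deg d (FreeAlgebra.ι R x) = d x := by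
  simp [differential, leibnizHom]

theorem leibnizHom_entries (deg : X → ℤ) (d : X → FreeAlgebra R X) (a : FreeAlgebra R X) :
    leibnizHom deg d a 0 0 = parity deg a ∧ leibnizHom deg d a 1 0 = 0 ∧
      leibnizHom deg d a 1 1 = a := by
  induction a using FreeAlgebra.induction with
  | grade0 r => simp [Matrix.algebraMap_matrix_apply]
  | grade1 x => simp [leibnizHom, parity]
  | mul a b ha hb => simp [Matrix.mul_apply, ha, hb]
  | add a b ha hb => simp [ha, hb]

theorem differential_mul (deg : X → ℤ) (d : X → FreeAlgebra R X) (a b : FreeAlgebra R X) :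
    differential deg d (a * b) =
      differential deg d a * b + parity deg a * differential deg d b := by
  have ha := leibnizHom_entries deg d a
  have hb := leibnizHom_entries deg d b
  simp only [differential, LinearMap.coe_mk, AddHom.coe_mk, map_mul, Matrix.mul_apply,
    Fin.sum_univ_two, ha.1, hb.2.2]
  exact add_comm _ _

/-- An augmentation: a unital ring homomorphism to a field `K` in degree `0` with zero
differential, which is compatible with the grading and the differential. -/
def IsAugmentation {K : Type*} [Field K] (deg : X → ℤ) (d : X → FreeAlgebra R X)
    (ε : FreeAlgebra R X →+* K) : Prop :=
  (∀ x, deg x ≠ 0 → ε (FreeAlgebra.ι R x) = 0) ∧ ∀ a, ε (differential deg d a) = 0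

end Differential

/-!
### The border DGA `A_n(μ)`

The strands over a vertical line are listed from top to bottom, and a Maslov potential on them is
a list `μ` of integers.
-/

/-- Index set of the generators `k_{ab}`, `a < b`. -/
abbrev Chord (n : ℕ) : Type := {p : Fin n × Fin n // p.1 < p.2}

/-- The strictly upper triangular matrix with entries `x_{ab}`, `a < b`. -/
def chordMatrix {n : ℕ} {R : Type*} [Zero R] (x : Chord n → R) : Matrix (Fin n) (Fin n) R :=
  fun a b => if h : a < b then x ⟨(a, b), h⟩ else 0

/-- `|k_{ab}| = μ(a) - μ(b) - 1`. -/
def chordDeg (μ : List ℤ) (k : Chord μ.length) : ℤ := μ.get k.1.1 - μ.get k.1.2 - 1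

/-- `∂ k_{ab} = ∑_{a < c < b} (-1)^{|k_{ac}| - 1} k_{ac} k_{cb}`, for elements `k_{ab}` of any
ring. -/
def chordD (μ : List ℤ) {R : Type*} [Ring R] (x : Chord μ.length → R) (k : Chord μ.length) : R :=
  ∑ c : Fin μ.length, (μ.get k.1.1 - μ.get c - 1 - 1).negOnePow •
    (chordMatrix x k.1.1 c * chordMatrix x c k.1.2)

/-- The algebra of the border DGA `A_n(μ)`. -/
abbrev BorderAlg (μ : List ℤ) : Type := FreeAlgebra ℤ (Chord μ.length)

/-- The differential of the border DGA on generators. -/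
noncomputable def borderD (μ : List ℤ) (k : Chord μ.length) : BorderAlg μ :=
  chordD μ (FreeAlgebra.ι ℤ) k

/-- The endomorphism `d(e_a) = ∑_{a < b} (-1)^{μ(a)} ε(k_{ab}) e_b` of `Kⁿ` that belongs to
`ε : A_n(μ) → K`; it is a Morse complex if `ε` is an augmentation. -/
noncomputable def morse {K : Type*} [Field K] (μ : List ℤ) (ε : BorderAlg μ →+* K) :
    (Fin μ.length → K) →ₗ[K] (Fin μ.length → K) :=
  Matrix.toLin' (Matrix.of fun b a =>
    (μ.get a).negOnePow • chordMatrix (fun k => ε (FreeAlgebra.ι ℤ k)) a b)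

/-- `ε` is acyclic: the cohomology of its Morse complex vanishes. -/
def IsAcyclic {K : Type*} [Field K] (μ : List ℤ) (ε : BorderAlg μ →+* K) : Prop :=
  LinearMap.ker (morse μ ε) = LinearMap.range (morse μ ε)

/-!
### Front projections with Maslov potentials

A regular front, all of whose singular points have different `x`-coordinates, is a concatenation
of elementary fronts: some horizontal strands above, one singular piece, and some horizontal
strands below.
-/

/-- The singular piece of an elementary front, from strands on its left with Maslov potential `l`
to strands on its right with Maslov potential `r` (listed from top to bottom).

A base point is oriented from left to right, and from the upper to the lower strand if it lies at
a cusp (`based = true`). At a cusp the potential of the upper strand exceeds that of the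
lower one by `1`; at a vertex there is no condition. -/
inductive Piece : List ℤ → List ℤ → Type
  | leftCusp (based : Bool) (m : ℤ) : Piece [] [m + 1, m]
  | rightCusp (based : Bool) (m : ℤ) : Piece [m + 1, m] []
  | crossing (p q : ℤ) : Piece [p, q] [q, p]
  | basePoint (p : ℤ) : Piece [p] [p]
  | vertex (l r : List ℤ) (h : 0 < l.length + r.length) : Piece l r

/-- The front of a bordered Legendrian graph with a Maslov potential, which restricts to `μL` and
to the second index on the left and right borders. -/
inductive Front (μL : List ℤ) : List ℤ → Type
  | trivial : Front μL μL
  | concat {l r : List ℤ} (u w : List ℤ) (T : Front μL (u ++ (l ++ w))) (E : Piece l r) :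
      Front μL (u ++ (r ++ w))

/-!
### Generators

The generators are those of Ng's resolution: one for each crossing of the front, one for the
crossing of the kink at each right cusp, `ℓ(ℓ-1)/2` for the crossings of the half twist to the left
of a vertex of type `(ℓ, r)`, and the spirals around the vertices.

The half-edges of a vertex of type `(ℓ, r)` are labelled by `ZMod (ℓ + r)`, in the Lagrangian
projection clockwise: the left ones are `0, …, ℓ - 1`, and the right ones from top to bottom are
`ℓ, …, ℓ + r - 1`. In the front both groups run from top to bottom.
-/

/-- The potential of the half-edge `a` of a vertex. -/
def halfEdgePotential (l r : List ℤ) (a : ZMod (l.length + r.length)) : ℤ :=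
  (l ++ r).getD a.val 0

/-- `n(v, a, i)`: how often the spiral that starts at the half-edge `a` and runs clockwise through
`i` sectors meets the vertical line through the vertex. That line is met in the sector after the
last left half-edge and in the sector after the last right half-edge; if all half-edges lie on one side,
these are the same sector, and the line is met twice there. -/
def spiralCount (l r : ℕ) (a : ZMod (l + r)) (i : ℕ) : ℤ :=
  ∑ j ∈ Finset.range i,
    ((if a + (j : ZMod (l + r)) + 1 = (l : ZMod (l + r)) then 1 else 0) +
      (if a + (j : ZMod (l + r)) + 1 = 0 then 1 else 0))

/-- `|v_{a,i}| = μ(a) - μ(a + i) + n(v, a, i) - 1`. -/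
def spiralDeg (l r : List ℤ) (a : ZMod (l.length + r.length)) (i : ℕ) : ℤ :=
  halfEdgePotential l r a - halfEdgePotential l r (a + (i : ZMod (l.length + r.length))) +
    (spiralCount l.length r.length a i - 1)

namespace Piece

/-- The base points of a piece. -/
def Base : {l r : List ℤ} → Piece l r → Type
  | _, _, leftCusp based _ => {_x : Unit // based = true}
  | _, _, rightCusp based _ => {_x : Unit // based = true}
  | _, _, crossing _ _ => Empty
  | _, _, basePoint _ => Unit
  | _, _, vertex _ _ _ => Empty

/-- The generators of a piece.  For a vertex: the crossings `c_{p,q}` of its half twist, and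
the spirals `v_{a,i}`, `i ≥ 1`. -/
def Gen : {l r : List ℤ} → Piece l r → Type
  | _, _, leftCusp _ _ => Empty
  | _, _, rightCusp _ _ => Unit
  | _, _, crossing _ _ => Unit
  | _, _, basePoint _ => Empty
  | _, _, vertex l r _ => Chord l.length ⊕ (ZMod (l.length + r.length) × ℕ+)

/-- The grading of the generators. -/
def deg : {l r : List ℤ} → (E : Piece l r) → E.Gen → ℤ
  | _, _, leftCusp _ _, g => nomatch g
  | _, _, rightCusp _ _, _ => 1
  | _, _, crossing p q, _ => p - q
  | _, _, basePoint _, g => nomatch g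
  | _, _, vertex l r _, g =>
      Sum.elim (fun c => l.get c.1.1 - l.get c.1.2) (fun v => spiralDeg l r v.1 v.2) g

end Piece

/-- The unit `t` of a cusp with a base point, and `1` for a cusp without. -/
def cuspUnit {R : Type*} [Ring R] {based : Bool} (t : {_x : Unit // based = true} → Rˣ) : Rˣ :=
  if h : based = true then t ⟨(), h⟩ else 1

section Vertex

variable {l r : List ℤ} {R : Type*} [Ring R]

/-- `v_{a,i}`, with the value `0` for `i = 0`. -/
def spiral {n : ℕ} (v : ZMod n × ℕ+ → R) (a : ZMod n) (i : ℕ) : R :=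
  if h : 0 < i then v (a, ⟨i, h⟩) else 0

/-- `∂ v_{a,i} = δ_{i,n} + ∑_{i₁ + i₂ = i} (-1)^{|v_{a,i₁}| - 1} v_{a,i₁} v_{a+i₁,i₂}`, where
`n = ℓ + r`. -/
def spiralD (l r : List ℤ) (v : ZMod (l.length + r.length) × ℕ+ → R)
    (a : ZMod (l.length + r.length)) (i : ℕ) : R :=
  (if i = l.length + r.length then 1 else 0) +
    ∑ s ∈ Finset.HasAntidiagonal.antidiagonal i, (spiralDeg l r a s.1 - 1).negOnePow •
      (spiral v a s.1 * spiral v (a + (s.1 : ZMod (l.length + r.length))) s.2)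

/-- Spirals from the left half-edge `p` to the left half-edge `q` that make `j` additional full
turns. -/
def spiralLL (j : ℕ) (v : ZMod (l.length + r.length) × ℕ+ → R) :
    Matrix (Fin l.length) (Fin l.length) R :=
  fun p q => spiral v ((p : ℕ) : ZMod (l.length + r.length))
    (j * (l.length + r.length) + (q : ℕ) - (p : ℕ))

/-- Spirals from a left half-edge clockwise to a right half-edge. -/
def spiralLR (v : ZMod (l.length + r.length) × ℕ+ → R) :
    Matrix (Fin l.length) (Fin r.length) R :=
  fun p q => spiral v ((p : ℕ) : ZMod (l.length + r.length)) (l.length + (q : ℕ) - (p : ℕ))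

/-- Spirals from a right half-edge clockwise to a left half-edge. -/
def spiralRL (v : ZMod (l.length + r.length) × ℕ+ → R) :
    Matrix (Fin r.length) (Fin l.length) R :=
  fun p q => spiral v ((l.length + (p : ℕ) : ℕ) : ZMod (l.length + r.length))
    (r.length + (q : ℕ) - (p : ℕ))

/-- Spirals from a right half-edge down to a right half-edge. -/
def spiralRR (v : ZMod (l.length + r.length) × ℕ+ → R) :
    Matrix (Fin r.length) (Fin r.length) R :=
  fun p q => spiral v ((l.length + (p : ℕ) : ℕ) : ZMod (l.length + r.length)) ((q : ℕ) - (p : ℕ))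

/-- Upper boundary of the half twist: follow a strand to the right and turn at most once, into
the sector above a crossing. -/
def twistAbove (c : Chord l.length → R) : Matrix (Fin l.length) (Fin l.length) R :=
  1 + chordMatrix c

/-- Lower boundary of the half twist: follow a strand to the left and turn any number of times,
into the sectors below crossings `c`, each of which carries the orientation sign
`(-1)^{|c| - 1}`. -/
def twistBelow (c : Chord l.length → R) : Matrix (Fin l.length) (Fin l.length) R :=
  ∑ m ∈ Finset.range l.length,
    (chordMatrix fun k : Chord l.length => (l.get k.1.1 - l.get k.1.2 - 1).negOnePow • c k) ^ m

end Vertex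

/-!
### Counting polygons

Fix a vertical line in the resolution and two strands `a < b` over it.  A half-disk for `(a, b)` is
an immersed polygon to the left of the line whose right side is the segment of the line between
`a` and `b`, and whose corners are as for the differential.  Its word is read counterclockwise,
starting on the strand `a`.

Sweep the half-disk to the left over one elementary front, with upper strands `U`, lower strands
`W`, and the strands `L` and `M` on the left and right of the singular piece.  What remains are
half-disks over the line to the left.  There are four kinds of passages, which contribute matrices
of words:

* `fromAbove : L × M`. The lower side of the half-disk is a strand in `M` and is continued by a
  strand in `L`;
* `toBelow : M × L`. The same for its upper side;
* `closed : M × M`. Both sides belong to `M` and the half-disk ends in the piece;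
* `around : L × L`. The half-disk contains the singular piece between its two sides, and its
  boundary enters from the left along a strand in `L`, runs around the piece, and leaves to the
  left.
-/

namespace Piece

/-- At a crossing `c` the sectors above and below have signs `1` and `(-1)^{|c| - 1}`. -/
def fromAbove : {l r : List ℤ} → (E : Piece l r) → {R : Type*} → [Ring R] →
    (E.Gen → R) → (E.Base → Rˣ) → Matrix (Fin l.length) (Fin r.length) R
  | _, _, leftCusp _ _, _, _, _, _ => 0
  | _, _, rightCusp _ _, _, _, _, _ => 0
  | _, _, crossing _ _, _, _, x, _ => !![x (), 1; 1, 0]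
  | _, _, basePoint _, R, _, _, t => !![((t () : Rˣ) : R)]
  | _, _, vertex _ _ _, _, _, x, _ => twistAbove (x ∘ Sum.inl) * spiralLR (x ∘ Sum.inr)

def toBelow : {l r : List ℤ} → (E : Piece l r) → {R : Type*} → [Ring R] →
    (E.Gen → R) → (E.Base → Rˣ) → Matrix (Fin r.length) (Fin l.length) R
  | _, _, leftCusp _ _, _, _, _, _ => 0
  | _, _, rightCusp _ _, _, _, _, _ => 0
  | _, _, crossing p q, _, _, x, _ => !![0, 1; 1, (p - q - 1).negOnePow • x ()]
  | _, _, basePoint _, R, _, _, t => !![(((t ())⁻¹ : Rˣ) : R)]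
  | _, _, vertex _ _ _, _, _, x, _ => spiralRL (x ∘ Sum.inr) * twistBelow (x ∘ Sum.inl)

def closed : {l r : List ℤ} → (E : Piece l r) → {R : Type*} → [Ring R] →
    (E.Gen → R) → (E.Base → Rˣ) → Matrix (Fin r.length) (Fin r.length) R
  | _, _, leftCusp _ _, R, _, _, t => !![0, ((cuspUnit t : Rˣ) : R); 0, 0]
  | _, _, rightCusp _ _, _, _, _, _ => 0
  | _, _, crossing _ _, _, _, _, _ => 0
  | _, _, basePoint _, _, _, _, _ => 0
  | _, _, vertex _ _ _, _, _, x, _ => spiralRR (x ∘ Sum.inr)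

/-- At a right cusp the boundary passes the kink: it enters the loop straight or by a turn above
`c`, runs clockwise through the loop, and leaves it straight or by a turn below `c`. -/
def around : {l r : List ℤ} → (E : Piece l r) → {R : Type*} → [Ring R] →
    (E.Gen → R) → (E.Base → Rˣ) → Matrix (Fin l.length) (Fin l.length) R
  | _, _, leftCusp _ _, _, _, _, _ => 0
  | _, _, rightCusp _ _, R, _, x, t =>
      !![x (); 1] * !![(((cuspUnit t)⁻¹ : Rˣ) : R)] * !![1, x ()]
  | _, _, crossing _ _, _, _, _, _ => 0
  | _, _, basePoint _, _, _, _, _ => 0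
  | _, _, vertex _ _ _, _, _, x, _ =>
      twistAbove (x ∘ Sum.inl) * spiralLL 1 (x ∘ Sum.inr) * twistBelow (x ∘ Sum.inl)

/-- The differential of the generators of a piece, where `a` is the matrix of half-disk counts over
the line to the left, for the strands that enter the piece.

A crossing has polygons to its left, which are half-disks, and, if it belongs to a kink or to the
half twist of a vertex, polygons to its right; the latter end in the loop or at the vertex and
carry the orientation sign `(-1)^{|c| - 1}`. -/
def d : {l r : List ℤ} → (E : Piece l r) → {R : Type*} → [Ring R] →
    (a : Matrix (Fin l.length) (Fin l.length) R) → (E.Gen → R) → (E.Base → Rˣ) → E.Gen → R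
  | _, _, leftCusp _ _, _, _, _, _, _, g => nomatch g
  | _, _, rightCusp _ _, R, _, a, _, t, _ => a 0 1 + ((cuspUnit t : Rˣ) : R)
  | _, _, crossing _ _, _, _, a, _, _, _ => a 0 1
  | _, _, basePoint _, _, _, _, _, _, g => nomatch g
  | _, _, vertex l r _, _, _, a, x, _, g =>
      Sum.elim
        (fun c => (a * twistAbove (x ∘ Sum.inl)) c.1.1 c.1.2 +
          (l.get c.1.1 - l.get c.1.2 - 1).negOnePow •
            (twistAbove (x ∘ Sum.inl) * spiralLL 0 (x ∘ Sum.inr)) c.1.1 c.1.2)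
        (fun v => spiralD l r (x ∘ Sum.inr) v.1 v.2) g

end Piece

/-- Splitting of strands into those above, in, and below a singular piece. -/
def blocks (u m w : List ℤ) :
    Fin (u ++ (m ++ w)).length ≃ Fin u.length ⊕ (Fin m.length ⊕ Fin w.length) :=
  (finCongr (by simp)).trans
    (finSumFinEquiv.symm.trans (Equiv.sumCongr (Equiv.refl _) finSumFinEquiv.symm))

section Sweep

variable {R : Type*} [Ring R] {U L M W : Type} [Fintype L]

/-- Half-disk counts over the line to the right of an elementary front, from those over the line
to its left.  All half-disks are continued to the left, with the passages described above. -/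
def sweep (P : Matrix L M R) (Q : Matrix M L R) (C : Matrix M M R) (N : Matrix L L R)
    (A : Matrix (U ⊕ (L ⊕ W)) (U ⊕ (L ⊕ W)) R) : Matrix (U ⊕ (M ⊕ W)) (U ⊕ (M ⊕ W)) R
  | .inl i, .inl j => A (.inl i) (.inl j)
  | .inl i, .inr (.inl b) => ∑ p, A (.inl i) (.inr (.inl p)) * P p b
  | .inl i, .inr (.inr j) => A (.inl i) (.inr (.inr j)) +
      ∑ p, ∑ q, A (.inl i) (.inr (.inl p)) * N p q * A (.inr (.inl q)) (.inr (.inr j))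
  | .inr (.inl a), .inr (.inl b) => C a b
  | .inr (.inl a), .inr (.inr j) => ∑ q, Q a q * A (.inr (.inl q)) (.inr (.inr j))
  | .inr (.inr i), .inr (.inr j) => A (.inr (.inr i)) (.inr (.inr j))
  | .inr _, .inl _ => 0
  | .inr (.inr _), .inr (.inl _) => 0

end Sweep

/-!
### The bordered Chekanov-Eliashberg DGA
-/

namespace Front

variable {μL : List ℤ}

/-- The base points of a front. -/
def Base : {μR : List ℤ} → Front μL μR → Type
  | _, trivial => Empty
  | _, concat _ _ T E => T.Base ⊕ E.Base

/-- The generators: those of the left border, and those of the resolution. -/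
def Gen : {μR : List ℤ} → Front μL μR → Type
  | _, trivial => Chord μL.length
  | _, concat _ _ T E => T.Gen ⊕ E.Gen

/-- The grading of the generators. -/
def deg : {μR : List ℤ} → (T : Front μL μR) → T.Gen → ℤ
  | _, trivial, k => chordDeg μL k
  | _, concat _ _ T E, g => Sum.elim T.deg E.deg g

/-- The matrix of half-disk counts over the right border, with given values of the generators and
base points in a ring. -/
def halfDisks : {μR : List ℤ} → (T : Front μL μR) → {R : Type*} → [Ring R] →
    (T.Gen → R) → (T.Base → Rˣ) → Matrix (Fin μR.length) (Fin μR.length) R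
  | _, trivial, _, _, x, _ => chordMatrix x
  | _, concat (l := l) (r := r) u w T E, _, _, x, t =>
      Matrix.reindex (blocks u r w).symm (blocks u r w).symm
        (sweep (E.fromAbove (x ∘ Sum.inr) (t ∘ Sum.inr)) (E.toBelow (x ∘ Sum.inr) (t ∘ Sum.inr))
          (E.closed (x ∘ Sum.inr) (t ∘ Sum.inr)) (E.around (x ∘ Sum.inr) (t ∘ Sum.inr))
          (Matrix.reindex (blocks u l w) (blocks u l w)
            (T.halfDisks (x ∘ Sum.inl) (t ∘ Sum.inl))))

/-- The differential of the generators, with given values of the generators and base points in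
a ring. -/
def genD : {μR : List ℤ} → (T : Front μL μR) → {R : Type*} → [Ring R] →
    (T.Gen → R) → (T.Base → Rˣ) → T.Gen → R
  | _, trivial, _, _, x, _, k => chordD μL x k
  | _, concat (l := l) u w T E, _, _, x, t, g =>
      Sum.elim (T.genD (x ∘ Sum.inl) (t ∘ Sum.inl))
        (E.d (fun p q => T.halfDisks (x ∘ Sum.inl) (t ∘ Sum.inl)
            ((blocks u l w).symm (.inr (.inl p))) ((blocks u l w).symm (.inr (.inl q))))
          (x ∘ Sum.inr) (t ∘ Sum.inr)) g

variable {μR : List ℤ}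

/-- The Chekanov-Eliashberg algebra: the free algebra on the generators over the Laurent
polynomial ring of the base points. -/
abbrev Alg (T : Front μL μR) : Type := FreeAlgebra (Laurent T.Base) T.Gen

/-- The generators, as elements of the algebra. -/
noncomputable def x (T : Front μL μR) : T.Gen → T.Alg := FreeAlgebra.ι (Laurent T.Base)

/-- The base points, as invertible elements of the algebra. -/
noncomputable def t (T : Front μL μR) (b : T.Base) : T.Algˣ :=
  Units.map (algebraMap (Laurent T.Base) T.Alg).toMonoidHom (Laurent.t b)

/-- The differential of the Chekanov-Eliashberg DGA on generators; it is extended by `∂t = 0` and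
the Leibniz rule. -/
noncomputable def d (T : Front μL μR) (g : T.Gen) : T.Alg := T.genD T.x T.t g

/-- The generators of the left border. -/
def leftGen : {μR : List ℤ} → (T : Front μL μR) → Chord μL.length → T.Gen
  | _, trivial, k => k
  | _, concat _ _ T _, k => Sum.inl (T.leftGen k)

/-- The structure map `φ_L` of the left border, the inclusion of generators. -/
noncomputable def phiL (T : Front μL μR) : BorderAlg μL →+* T.Alg :=
  (FreeAlgebra.lift ℤ fun k => T.x (T.leftGen k) : BorderAlg μL →ₐ[ℤ] T.Alg).toRingHom

/-- The structure map `φ_R` of the right border, which sends `k_{ab}` to the count of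
half-disks for `(a, b)`. -/
noncomputable def phiR (T : Front μL μR) : BorderAlg μR →+* T.Alg :=
  (FreeAlgebra.lift ℤ fun k : Chord μR.length => T.halfDisks T.x T.t k.1.1 k.1.2 :
    BorderAlg μR →ₐ[ℤ] T.Alg).toRingHom

end Front

end LegendrianGraph

open Matrix

namespace LegendrianGraph

/-!
### Exact square-zero matrices
-/

/-! Applying `ε` to all words turns the half-disk counts over a vertical line into a matrix `A` over
`K`. It is strictly upper triangular and, since `ε` lives in degree `0`, nonzero only where the
potential drops by `1`. Up to signs, `z ↦ z ᵥ* A` is the Morse differential: that of `ε ∘ φ_L` over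
the left border and that of `ε ∘ φ_R` over the right one. So it suffices that each elementary front
preserves `A * A = 0` and exactness.

Since `ε` kills the differentials of the generators of a piece, its passages form a homotopy
equivalence (`IsPassage`) between the diagonal block `a` of `A` on the entering strands and the
complex `C` on the leaving strands: `P` and `Q` are chain maps, inverse to each other up to the
homotopies `N` and `S`. At a crossing or a base point `a = 0`, and `P`, `Q` are inverse matrices. At
a cusp one side is empty and the other contractible. At a vertex the spirals form, on the universal
cover of the punctured neighbourhood, a matrix whose square is the translation by one full turn
(`sum_coverSpiral_mul`). The blocks of this identity are the required relations
(`isPassage_spirals`), and the half twist only conjugates them (`IsPassage.conj`).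

`ExactSquareZero.sweep` extends the local equivalence by the identity on the remaining strands;
exactness is then transported by `ExactSquareZero.of_homotopy`, and
`Front.exactSquareZero_halfDisks` is the induction over the front. -/

/-- A square-zero matrix whose row complex is exact. -/
structure ExactSquareZero {K ι : Type*} [Field K] [Fintype ι] (A : Matrix ι ι K) : Prop where
  mul_self : A * A = 0
  exact : ∀ z, z ᵥ* A = 0 → ∃ y, z = y ᵥ* A

theorem ExactSquareZero.reindex {K ι κ : Type*} [Field K] [Fintype ι] [Fintype κ]
    {A : Matrix ι ι K} (h : ExactSquareZero A) (e : ι ≃ κ) :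
    ExactSquareZero (Matrix.reindex e e A) where
  mul_self := by
    simp only [Matrix.reindex_apply, Matrix.submatrix_mul_equiv, h.mul_self]
    rfl
  exact z hz := by
    simp only [Matrix.reindex_apply, Matrix.submatrix_vecMul_equiv, Equiv.symm_symm] at hz ⊢
    obtain ⟨y, hy⟩ := h.exact (z ∘ e) (by
      funext i
      simpa using congrFun hz (e i))
    refine ⟨y ∘ e.symm, ?_⟩
    have : (y ∘ e.symm) ∘ e = y := by funext i; simp
    rw [this, ← hy]
    funext i
    simp

/-- A complex that is a homotopy retract of an exact one up to an automorphism is exact. -/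
theorem ExactSquareZero.of_homotopy {K ι κ : Type*} [Field K] [Fintype ι] [Fintype κ]
    [DecidableEq κ] {A : Matrix ι ι K} (hA : ExactSquareZero A) {B : Matrix κ κ K}
    (hB : B * B = 0) {Φ : Matrix ι κ K} {Ψ : Matrix κ ι K} (hΦ : A * Φ = Φ * B)
    (hΨ : Ψ * A = B * Ψ) (h : Matrix κ κ K) (hJ : IsUnit (Ψ * Φ + B * h + h * B).det) :
    ExactSquareZero B where
  mul_self := hB
  exact z hz := by
    -- A cycle `z` of `B` maps to a cycle of `A`, hence to a boundary; mapping back, `z ᵥ* J` is a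
    -- boundary of `B`. As `J` is a chain automorphism, so is `z`.
    obtain ⟨y, hy⟩ := hA.exact (z ᵥ* Ψ) (by
      rw [Matrix.vecMul_vecMul, hΨ, ← Matrix.vecMul_vecMul, hz, Matrix.zero_vecMul])
    set J := Ψ * Φ + B * h + h * B with hJdef
    have hc : B * J = J * B := by
      have h1 : B * (Ψ * Φ) = Ψ * Φ * B := by
        rw [← Matrix.mul_assoc, ← hΨ, Matrix.mul_assoc, hΦ, Matrix.mul_assoc]
      have h2 : B * (B * h) = 0 := by rw [← Matrix.mul_assoc, hB, Matrix.zero_mul]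
      have h3 : h * B * B = 0 := by rw [Matrix.mul_assoc, hB, Matrix.mul_zero]
      rw [hJdef, Matrix.mul_add, Matrix.mul_add, Matrix.add_mul, Matrix.add_mul, h1, h2, h3,
        Matrix.mul_assoc B h B, add_zero, add_zero]
    have hc' : B * J⁻¹ = J⁻¹ * B := by
      calc B * J⁻¹ = J⁻¹ * (J * B) * J⁻¹ := by
            rw [← Matrix.mul_assoc, Matrix.nonsing_inv_mul _ hJ, Matrix.one_mul]
        _ = J⁻¹ * B := by
            rw [← hc, Matrix.mul_assoc, Matrix.mul_assoc, Matrix.mul_nonsing_inv _ hJ,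
              Matrix.mul_one]
    have hzJ : z ᵥ* J = (y ᵥ* Φ + z ᵥ* h) ᵥ* B := by
      rw [hJdef, Matrix.vecMul_add, Matrix.vecMul_add, ← Matrix.vecMul_vecMul z Ψ, hy,
        ← Matrix.vecMul_vecMul z B, hz, Matrix.zero_vecMul, Matrix.vecMul_vecMul, hΦ,
        Matrix.add_vecMul, Matrix.vecMul_vecMul, Matrix.vecMul_vecMul, add_zero]
    refine ⟨(y ᵥ* Φ + z ᵥ* h) ᵥ* J⁻¹, ?_⟩
    calc z = (z ᵥ* J) ᵥ* J⁻¹ := by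
          rw [Matrix.vecMul_vecMul, Matrix.mul_nonsing_inv _ hJ, Matrix.vecMul_one]
      _ = _ := by rw [hzJ, Matrix.vecMul_vecMul, hc', Matrix.vecMul_vecMul]

/-!
### Block upper triangular matrices
-/

section BlockTriangular

variable {R U L W U' L' W' U'' L'' W'' : Type*}

/-- The block upper triangular matrix with three block rows and columns. -/
def blockTri [Zero R] (a : Matrix U U' R) (b : Matrix U L' R) (c : Matrix U W' R)
    (d : Matrix L L' R) (e : Matrix L W' R) (f : Matrix W W' R) :
    Matrix (U ⊕ (L ⊕ W)) (U' ⊕ (L' ⊕ W')) R :=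
  Matrix.fromBlocks a (Matrix.fromCols b c) 0 (Matrix.fromBlocks d e 0 f)

theorem blockTri_mul [Ring R] [Fintype U'] [Fintype L'] [Fintype W']
    (a : Matrix U U' R) (b : Matrix U L' R) (c : Matrix U W' R)
    (d : Matrix L L' R) (e : Matrix L W' R) (f : Matrix W W' R)
    (a' : Matrix U' U'' R) (b' : Matrix U' L'' R) (c' : Matrix U' W'' R)
    (d' : Matrix L' L'' R) (e' : Matrix L' W'' R) (f' : Matrix W' W'' R) :
    blockTri a b c d e f * blockTri a' b' c' d' e' f' =
      blockTri (a * a') (a * b' + b * d') (a * c' + b * e' + c * f')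
        (d * d') (d * e' + e * f') (f * f') := by
  ext (i | i | i) (j | j | j) <;>
    simp [blockTri, Matrix.mul_apply, Matrix.fromCols, add_assoc]

theorem blockTri_add [Ring R]
    (a : Matrix U U' R) (b : Matrix U L' R) (c : Matrix U W' R)
    (d : Matrix L L' R) (e : Matrix L W' R) (f : Matrix W W' R)
    (a' : Matrix U U' R) (b' : Matrix U L' R) (c' : Matrix U W' R)
    (d' : Matrix L L' R) (e' : Matrix L W' R) (f' : Matrix W W' R) :
    blockTri a b c d e f + blockTri a' b' c' d' e' f' =
      blockTri (a + a') (b + b') (c + c') (d + d') (e + e') (f + f') := by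
  ext (i | i | i) (j | j | j) <;> simp [blockTri, Matrix.fromCols]

theorem det_blockTri [CommRing R] [Fintype U] [Fintype L] [Fintype W] [DecidableEq U]
    [DecidableEq L] [DecidableEq W] (a : Matrix U U R) (b : Matrix U L R) (c : Matrix U W R)
    (d : Matrix L L R) (e : Matrix L W R) (f : Matrix W W R) :
    (blockTri a b c d e f).det = a.det * (d.det * f.det) := by
  rw [blockTri, Matrix.det_fromBlocks_zero₂₁, Matrix.det_fromBlocks_zero₂₁]

theorem blockTri_inj [Zero R] {a a' : Matrix U U' R} {b b' : Matrix U L' R} {c c' : Matrix U W' R}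
    {d d' : Matrix L L' R} {e e' : Matrix L W' R} {f f' : Matrix W W' R} :
    blockTri a b c d e f = blockTri a' b' c' d' e' f' ↔
      a = a' ∧ b = b' ∧ c = c' ∧ d = d' ∧ e = e' ∧ f = f' := by
  simp only [blockTri, Matrix.fromBlocks_inj, Matrix.fromCols_inj.eq_iff]
  tauto

theorem blockTri_zero [Zero R] :
    (0 : Matrix (U ⊕ (L ⊕ W)) (U' ⊕ (L' ⊕ W')) R) = blockTri 0 0 0 0 0 0 := by
  ext (i | i | i) (j | j | j) <;> simp [blockTri, Matrix.fromCols]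

end BlockTriangular

/-!
### Exactness is preserved by a sweep
-/

/-- The passages of a piece, with half-disk counts `a` to its left, form a homotopy equivalence. -/
structure IsPassage {K L M : Type*} [Field K] [Fintype L] [Fintype M] [DecidableEq L]
    [DecidableEq M] (a : Matrix L L K) (P : Matrix L M K) (Q : Matrix M L K) (C : Matrix M M K)
    (N : Matrix L L K) : Prop where
  mul_self : C * C = 0
  above : a * P = P * C
  below : C * Q = Q * a
  left : P * Q = 1 + a * N + N * a
  right : ∃ S : Matrix M M K, C * S + S * C + Q * P = 1

theorem sweep_blockTri {R : Type*} [Ring R] {U L M W : Type} [Fintype L] (P : Matrix L M R)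
    (Q : Matrix M L R) (C : Matrix M M R) (N : Matrix L L R) (a : Matrix U U R)
    (b : Matrix U L R) (c : Matrix U W R) (d : Matrix L L R) (e : Matrix L W R)
    (f : Matrix W W R) :
    sweep P Q C N (blockTri a b c d e f) =
      blockTri a (b * P) (c + b * N * e) C (Q * e) f := by
  ext (i | i | i) (j | j | j)
  case inl.inr.inr =>
    simp only [sweep, blockTri, Matrix.fromBlocks_apply₁₂,
      Matrix.fromBlocks_apply₂₂, Matrix.fromCols_apply_inl, Matrix.fromCols_apply_inr,
      Matrix.add_apply, Matrix.mul_apply, Finset.sum_mul]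
    rw [Finset.sum_comm]
  all_goals simp [sweep, blockTri, Matrix.fromCols, Matrix.mul_apply]

/-- The detour term `b * N * e` compensates for `P * Q` being only homotopic to `1`: it makes the
new matrix square to zero, and the entries `N * e` and `b * N` make the extensions of `P` and `Q`
chain maps. -/
theorem ExactSquareZero.sweep {K : Type*} [Field K] {U L M W : Type} [Fintype U] [Fintype L]
    [Fintype M] [Fintype W] [DecidableEq U] [DecidableEq L] [DecidableEq M] [DecidableEq W]
    {a : Matrix U U K} {b : Matrix U L K} {c : Matrix U W K} {d : Matrix L L K}
    {e : Matrix L W K} {f : Matrix W W K} (h : ExactSquareZero (blockTri a b c d e f))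
    {P : Matrix L M K} {Q : Matrix M L K} {C : Matrix M M K} {N : Matrix L L K}
    (hP : IsPassage d P Q C N) :
    ExactSquareZero (LegendrianGraph.sweep P Q C N (blockTri a b c d e f)) := by
  have h0 := h.mul_self
  rw [blockTri_mul, blockTri_zero, blockTri_inj] at h0
  obtain ⟨haa, hab, hac, hdd, hde, hff⟩ := h0
  obtain ⟨S, hS⟩ := hP.right
  rw [sweep_blockTri]
  have hab' : a * b = -(b * d) := eq_neg_of_add_eq_zero_left hab
  have hde' : e * f = -(d * e) := eq_neg_of_add_eq_zero_right hde
  have hPQ := hP.left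
  have hac' : a * c + c * f = -(b * e) := by
    rw [← sub_eq_zero, ← hac]; abel
  refine h.of_homotopy (Φ := blockTri 1 0 0 P (N * e) 1) (Ψ := blockTri 1 (b * N) 0 Q 0 1)
    ?_ ?_ ?_ (blockTri 0 0 0 S 0 0) ?_
  · rw [blockTri_mul, blockTri_zero, blockTri_inj]
    refine ⟨haa, ?_, ?_, hP.mul_self, ?_, hff⟩
    · rw [← Matrix.mul_assoc, hab', Matrix.neg_mul, Matrix.mul_assoc, Matrix.mul_assoc, hP.above]
      simp
    -- Grouped so that the relations of `A * A = 0` and the formula for `P * Q` apply.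
    · have e1 : a * (c + b * N * e) + b * P * (Q * e) + (c + b * N * e) * f =
          (a * c + c * f) + (a * b) * (N * e) + b * (P * Q) * e + b * N * (e * f) := by
        simp only [Matrix.mul_add, Matrix.add_mul, Matrix.mul_assoc]; abel
      rw [e1, hac', hab', hde', hPQ]
      simp only [Matrix.mul_add, Matrix.add_mul, Matrix.mul_assoc, Matrix.neg_mul, Matrix.mul_neg,
        Matrix.mul_one]
      abel
    · rw [← Matrix.mul_assoc, hP.below, Matrix.mul_assoc Q e f, hde', Matrix.mul_neg,
        Matrix.mul_assoc]
      simp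
  · rw [blockTri_mul, blockTri_mul, blockTri_inj]
    refine ⟨by simp, by simp, ?_, by simp [hP.above], ?_, by simp⟩
    · simp only [Matrix.mul_zero, Matrix.mul_one, Matrix.one_mul, Matrix.zero_mul, zero_add,
        add_zero, Matrix.mul_assoc]
      abel
    · rw [← Matrix.mul_assoc P, hPQ, Matrix.mul_assoc N e f, hde']
      simp only [Matrix.add_mul, Matrix.mul_assoc, Matrix.mul_neg,
        Matrix.mul_one, Matrix.one_mul]
      abel
  · rw [blockTri_mul, blockTri_mul, blockTri_inj]
    refine ⟨by simp, ?_, ?_, by simp [hP.below], by simp, by simp⟩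
    · rw [Matrix.mul_assoc b P Q, hPQ, ← Matrix.mul_assoc a b N, hab']
      simp only [Matrix.mul_add, Matrix.mul_assoc, Matrix.neg_mul,
        Matrix.mul_one, Matrix.one_mul]
      abel
    · simp only [Matrix.mul_zero, Matrix.mul_one, Matrix.one_mul, Matrix.zero_mul, add_zero,
        zero_add]
  -- The matrix is block upper triangular with identity diagonal blocks, the middle one by the
  -- choice of `S`. Its off-diagonal blocks need not vanish.
  · simp only [blockTri_mul, blockTri_add, det_blockTri]
    have : Q * P + C * S + S * C = 1 := by rw [← hS]; abel
    simp [this]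

/-!
### Naturality of half-disk counts
-/

section Naturality

variable {R S : Type*} [Ring R] [Ring S] (f : R →+* S)

theorem map_chordMatrix {n : ℕ} (x : Chord n → R) (a b : Fin n) :
    f (chordMatrix x a b) = chordMatrix (f ∘ x) a b := by
  unfold chordMatrix
  split_ifs <;> simp

theorem map_negOnePow_smul (n : ℤ) (a : R) : f (n.negOnePow • a) = n.negOnePow • f a := by
  rcases Int.even_or_odd n with h | h <;> simp [Int.negOnePow_even, Int.negOnePow_odd, h]

theorem map_chordD (μ : List ℤ) (x : Chord μ.length → R) (k : Chord μ.length) :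
    f (chordD μ x k) = chordD μ (f ∘ x) k := by
  simp [chordD, map_chordMatrix]

theorem map_cuspUnit {based : Bool} (t : {_x : Unit // based = true} → Rˣ) :
    Units.map (f : R →* S) (cuspUnit t) = cuspUnit (Units.map (f : R →* S) ∘ t) := by
  unfold cuspUnit
  split_ifs <;> simp

theorem map_spiral {n : ℕ} (v : ZMod n × ℕ+ → R) (a : ZMod n) (i : ℕ) :
    f (spiral v a i) = spiral (f ∘ v) a i := by
  unfold spiral
  split_ifs <;> simp

theorem map_spiralD (l r : List ℤ) (v : ZMod (l.length + r.length) × ℕ+ → R)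
    (a : ZMod (l.length + r.length)) (i : ℕ) :
    f (spiralD l r v a i) = spiralD l r (f ∘ v) a i := by
  simp [spiralD, map_spiral, apply_ite f]

variable {l r : List ℤ}

theorem map_twistAbove (c : Chord l.length → R) :
    (twistAbove c).map f = twistAbove (f ∘ c) := by
  ext i j
  simp [twistAbove, map_chordMatrix, Matrix.one_apply, apply_ite f]

theorem map_twistBelow (c : Chord l.length → R) :
    (twistBelow c).map f = twistBelow (f ∘ c) := by
  have h : ∀ M : Matrix (Fin l.length) (Fin l.length) R, M.map f = f.mapMatrix M := fun _ => rfl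
  simp only [twistBelow, h, map_sum, map_pow]
  refine Finset.sum_congr rfl fun m _ => congrArg (· ^ m) ?_
  ext i j
  simp only [RingHom.mapMatrix_apply, Matrix.map_apply, map_chordMatrix]
  congr 1
  funext k
  simp

theorem map_spiralLL (j : ℕ) (v : ZMod (l.length + r.length) × ℕ+ → R) :
    (spiralLL j v).map f = spiralLL j (f ∘ v) := by
  ext p q; exact map_spiral f _ _ _

theorem map_spiralLR (v : ZMod (l.length + r.length) × ℕ+ → R) :
    (spiralLR v).map f = spiralLR (f ∘ v) := by
  ext p q; exact map_spiral f _ _ _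

theorem map_spiralRL (v : ZMod (l.length + r.length) × ℕ+ → R) :
    (spiralRL v).map f = spiralRL (f ∘ v) := by
  ext p q; exact map_spiral f _ _ _

theorem map_spiralRR (v : ZMod (l.length + r.length) × ℕ+ → R) :
    (spiralRR v).map f = spiralRR (f ∘ v) := by
  ext p q; exact map_spiral f _ _ _

theorem Piece.map_fromAbove (E : Piece l r) (x : E.Gen → R) (t : E.Base → Rˣ) :
    (E.fromAbove x t).map f = E.fromAbove (f ∘ x) (Units.map (f : R →* S) ∘ t) := by
  cases E with
  | vertex l r h =>
    simp only [Piece.fromAbove, Matrix.map_mul, map_twistAbove, map_spiralLR]; rfl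
  | leftCusp => ext i j; simp [Piece.fromAbove]
  | rightCusp => ext i j; simp [Piece.fromAbove]
  | crossing p q => ext i j; fin_cases i <;> fin_cases j <;> simp [Piece.fromAbove]; rfl
  | basePoint p => ext i j; fin_cases i; fin_cases j; simp [Piece.fromAbove]; rfl

theorem Piece.map_toBelow (E : Piece l r) (x : E.Gen → R) (t : E.Base → Rˣ) :
    (E.toBelow x t).map f = E.toBelow (f ∘ x) (Units.map (f : R →* S) ∘ t) := by
  cases E with
  | vertex l r h =>
    simp only [Piece.toBelow, Matrix.map_mul, map_twistBelow, map_spiralRL]; rfl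
  | leftCusp => ext i j; simp [Piece.toBelow]
  | rightCusp => ext i j; simp [Piece.toBelow]
  | crossing p q =>
    ext i j; fin_cases i <;> fin_cases j <;> simp [Piece.toBelow]; rfl
  | basePoint p => ext i j; fin_cases i; fin_cases j; simp [Piece.toBelow]; rfl

theorem Piece.map_closed (E : Piece l r) (x : E.Gen → R) (t : E.Base → Rˣ) :
    (E.closed x t).map f = E.closed (f ∘ x) (Units.map (f : R →* S) ∘ t) := by
  cases E with
  | vertex l r h => simp only [Piece.closed, map_spiralRR]; rfl
  | leftCusp =>
    ext i j
    fin_cases i <;> fin_cases j <;> simp [Piece.closed]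
    erw [← map_cuspUnit]; rfl
  | rightCusp => ext i j; simp [Piece.closed]
  | crossing p q => ext i j; simp [Piece.closed]
  | basePoint p => ext i j; simp [Piece.closed]

theorem Piece.map_around (E : Piece l r) (x : E.Gen → R) (t : E.Base → Rˣ) :
    (E.around x t).map f = E.around (f ∘ x) (Units.map (f : R →* S) ∘ t) := by
  cases E with
  | vertex l r h =>
    simp only [Piece.around, Matrix.map_mul, map_twistAbove, map_twistBelow, map_spiralLL]; rfl
  | leftCusp => ext i j; simp [Piece.around]
  | rightCusp =>
    have h := map_cuspUnit f t
    simp only [Piece.around, Matrix.map_mul]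
    erw [← h]
    ext i j
    fin_cases i <;> fin_cases j <;> simp [Matrix.mul_apply] <;> rfl
  | crossing p q => ext i j; simp [Piece.around]
  | basePoint p => ext i j; simp [Piece.around]

theorem Piece.map_d (E : Piece l r) (a : Matrix (Fin l.length) (Fin l.length) R)
    (x : E.Gen → R) (t : E.Base → Rˣ) (g : E.Gen) :
    f (E.d a x t g) = E.d (a.map f) (f ∘ x) (Units.map (f : R →* S) ∘ t) g := by
  cases E with
  | vertex l r h =>
    rcases g with c | v
    · have h1 : ∀ M : Matrix (Fin l.length) (Fin l.length) R, ∀ i j, f (M i j) = M.map f i j :=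
        fun _ _ _ => rfl
      simp only [Piece.d, Sum.elim_inl, map_add, map_negOnePow_smul, h1, Matrix.map_mul,
        map_twistAbove, map_spiralLL]
      rfl
    · exact map_spiralD f _ _ _ _ _
  | leftCusp => exact nomatch g
  | rightCusp =>
    have h := map_cuspUnit f t
    simp only [Piece.d, map_add]
    erw [← h]
    rfl
  | crossing p q => rfl
  | basePoint p => exact nomatch g

theorem map_sweep {U L M W : Type} [Fintype L] (P : Matrix L M R) (Q : Matrix M L R)
    (C : Matrix M M R) (N : Matrix L L R) (A : Matrix (U ⊕ (L ⊕ W)) (U ⊕ (L ⊕ W)) R) :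
    (sweep P Q C N A).map f = sweep (P.map f) (Q.map f) (C.map f) (N.map f) (A.map f) := by
  ext (i | i | i) (j | j | j) <;> simp [sweep]

/-- The counts are noncommutative polynomials in the generators, base points and inverse base
points. Hence `ε` may be applied to the letters first, and the whole argument takes place over `K`.
-/
theorem Front.map_halfDisks {μL μR : List ℤ} (T : Front μL μR) (x : T.Gen → R)
    (t : T.Base → Rˣ) :
    (T.halfDisks x t).map f = T.halfDisks (f ∘ x) (Units.map (f : R →* S) ∘ t) := by
  induction T with
  | trivial => ext i j; exact map_chordMatrix f _ _ _
  | concat u w T E ih =>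
    have h : ∀ {ι κ : Type} (e : ι ≃ κ) (M : Matrix ι ι R),
        (Matrix.reindex e e M).map f = Matrix.reindex e e (M.map f) := fun _ _ => rfl
    simp only [Front.halfDisks, h, map_sweep, Piece.map_fromAbove, Piece.map_toBelow,
      Piece.map_closed, Piece.map_around, ih]
    rfl

theorem Front.map_genD {μL μR : List ℤ} (T : Front μL μR) (x : T.Gen → R)
    (t : T.Base → Rˣ) (g : T.Gen) :
    f (T.genD x t g) = T.genD (f ∘ x) (Units.map (f : R →* S) ∘ t) g := by
  induction T with
  | trivial => exact map_chordD f _ _ _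
  | concat u w T E ih =>
    rcases g with g | g
    · exact ih _ _ g
    · refine (Piece.map_d f E _ _ _ g).trans ?_
      have h := Front.map_halfDisks f T (x ∘ Sum.inl) (t ∘ Sum.inl)
      refine congrArg (fun a => E.d a _ _ g) ?_
      ext p q
      exact congrFun (congrFun h _) _

end Naturality

/-!
### Half-disk counts are upper triangular
-/

theorem blocks_symm_inl (u m w : List ℤ) (i : Fin u.length) :
    ((blocks u m w).symm (.inl i) : ℕ) = i := by
  simp [blocks]

theorem blocks_symm_inr_inl (u m w : List ℤ) (i : Fin m.length) :
    ((blocks u m w).symm (.inr (.inl i)) : ℕ) = u.length + i := by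
  simp [blocks]

theorem blocks_symm_inr_inr (u m w : List ℤ) (i : Fin w.length) :
    ((blocks u m w).symm (.inr (.inr i)) : ℕ) = u.length + (m.length + i) := by
  simp [blocks]

theorem get_blocks_symm_inl (u m w : List ℤ) (i : Fin u.length) :
    (u ++ (m ++ w)).get ((blocks u m w).symm (.inl i)) = u.get i := by
  simp [blocks_symm_inl]

theorem get_blocks_symm_inr_inl (u m w : List ℤ) (i : Fin m.length) :
    (u ++ (m ++ w)).get ((blocks u m w).symm (.inr (.inl i))) = m.get i := by
  simp [blocks_symm_inr_inl]

theorem get_blocks_symm_inr_inr (u m w : List ℤ) (i : Fin w.length) :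
    (u ++ (m ++ w)).get ((blocks u m w).symm (.inr (.inr i))) = w.get i := by
  simp [blocks_symm_inr_inr]

theorem Piece.closed_eq_zero {R : Type*} [Ring R] {l r : List ℤ} (E : Piece l r) (x : E.Gen → R)
    (t : E.Base → Rˣ) {i j : Fin r.length} (h : j ≤ i) : E.closed x t i j = 0 := by
  cases E with
  | vertex l r _ =>
    have : (j : ℕ) - (i : ℕ) = 0 := Nat.sub_eq_zero_of_le h
    simp [Piece.closed, spiralRR, spiral, this]
  | leftCusp =>
    rw [Fin.le_def] at h
    fin_cases i <;> fin_cases j <;> first | rfl | simp at h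
  | rightCusp => rfl
  | crossing p q => rfl
  | basePoint p => rfl

/-- The upper side of a half-disk lies above its lower side, and a sweep keeps the vertical order of
the three blocks. -/
theorem Front.halfDisks_eq_zero {R : Type*} [Ring R] {μL μR : List ℤ} (T : Front μL μR)
    (x : T.Gen → R) (t : T.Base → Rˣ) {i j : Fin μR.length} (h : j ≤ i) :
    T.halfDisks x t i j = 0 := by
  induction T with
  | trivial => simp [Front.halfDisks, chordMatrix, h.not_gt]
  | concat u w T E ih =>
    rename_i l r
    obtain ⟨i, rfl⟩ := (blocks u r w).symm.surjective i
    obtain ⟨j, rfl⟩ := (blocks u r w).symm.surjective j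
    simp only [Front.halfDisks, Matrix.reindex_apply, Matrix.submatrix_apply, Equiv.symm_symm,
      Equiv.apply_symm_apply]
    rw [Fin.le_def] at h
    rcases i with i | i | i <;> rcases j with j | j | j <;>
      simp only [blocks_symm_inl, blocks_symm_inr_inl, blocks_symm_inr_inr] at h
    · refine ih _ _ ?_
      rw [Fin.le_def, blocks_symm_inl, blocks_symm_inl]; exact h
    · omega
    · omega
    · rfl
    · exact Piece.closed_eq_zero E _ _ (by rw [Fin.le_def]; omega)
    · omega
    · rfl
    · rfl
    · refine ih _ _ ?_
      rw [Fin.le_def, blocks_symm_inr_inr, blocks_symm_inr_inr]; omega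

/-!
### Spirals in a field
-/

/-- Values of an augmentation vanish outside degree `0`, so the degree-dependent signs become
constant wherever they matter. -/
theorem negOnePow_smul_eq_of_ne {K : Type*} [Field K] {n m : ℤ} {y : K} (h : y ≠ 0 → n = m) :
    n.negOnePow • y = m.negOnePow • y := by
  by_cases hy : y = 0
  · simp [hy]
  · rw [h hy]

section Spiral

variable {K : Type*} [Field K] {l r : List ℤ}

/-- The spiral from the sector boundary `a` to the sector boundary `b` in the universal cover of
the punctured neighbourhood of a vertex. -/
def coverSpiral {n : ℕ} (v : ZMod n × ℕ+ → K) (a b : ℕ) : K := spiral v (a : ZMod n) (b - a)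

theorem coverSpiral_eq_zero {n : ℕ} (v : ZMod n × ℕ+ → K) {a b : ℕ} (h : b ≤ a) :
    coverSpiral v a b = 0 := by
  simp [coverSpiral, spiral, Nat.sub_eq_zero_of_le h]

theorem coverSpiral_add {n : ℕ} (v : ZMod n × ℕ+ → K) (a b : ℕ) :
    coverSpiral v (n + a) (n + b) = coverSpiral v a b := by
  simp [coverSpiral, Nat.add_sub_add_left]

variable {v : ZMod (l.length + r.length) × ℕ+ → K}

theorem spiral_eq_zero (hv : ∀ a i, spiralDeg l r a (i : ℕ+) ≠ 0 → v (a, i) = 0)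
    {a : ZMod (l.length + r.length)} {i : ℕ} (h : spiralDeg l r a i ≠ 0) :
    spiral v a i = 0 := by
  unfold spiral
  split_ifs with hi
  · exact hv a ⟨i, hi⟩ h
  · rfl

/-- This is `∂ v_{a,i} = 0` read on the universal cover: all signs are `-1`, because a first factor
that survives has degree `0`, and the term `δ` becomes the translation by a full turn. The cutoff
`N` is arbitrary, since terms with `c ≥ b` vanish. -/
theorem sum_coverSpiral_mul (hn : 0 < l.length + r.length)
    (hv : ∀ a i, spiralDeg l r a (i : ℕ+) ≠ 0 → v (a, i) = 0)
    (hD : ∀ a, ∀ i : ℕ+, spiralD l r v a i = 0) {a b N : ℕ} (hN : b ≤ N) :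
    ∑ c ∈ Finset.range N, coverSpiral v a c * coverSpiral v c b =
      if b = l.length + r.length + a then 1 else 0 := by
  rcases le_or_gt b a with hab | hab
  · rw [if_neg (by omega)]
    refine Finset.sum_eq_zero fun c _ => ?_
    rcases le_or_gt c a with hc | hc
    · rw [coverSpiral_eq_zero v hc, zero_mul]
    · rw [coverSpiral_eq_zero v (hab.trans hc.le), mul_zero]
  · have h1 : ∑ c ∈ Finset.range N, coverSpiral v a c * coverSpiral v c b =
        ∑ c ∈ Finset.range b, coverSpiral v a c * coverSpiral v c b := by
      symm
      refine Finset.sum_subset (Finset.range_mono hN) fun c _ hc => ?_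
      rw [coverSpiral_eq_zero v (a := c) (by simpa using hc), mul_zero]
    have h2 : ∑ c ∈ Finset.range b, coverSpiral v a c * coverSpiral v c b =
        ∑ i ∈ Finset.range (b - a),
          coverSpiral v a (a + i) * coverSpiral v (a + i) b := by
      rw [← Nat.add_sub_cancel' hab.le, Finset.sum_range_add, Nat.add_sub_cancel' hab.le,
        Finset.sum_eq_zero, zero_add]
      intro c hc
      rw [coverSpiral_eq_zero v (Finset.mem_range.1 hc).le, zero_mul]
    have h3 := hD (a : ZMod (l.length + r.length)) ⟨b - a, Nat.sub_pos_of_lt hab⟩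
    rw [PNat.mk_coe, spiralD] at h3
    have h4 : ∀ s ∈ Finset.HasAntidiagonal.antidiagonal (b - a),
        (spiralDeg l r (a : ZMod (l.length + r.length)) s.1 - 1).negOnePow •
          (spiral v (a : ZMod (l.length + r.length)) s.1 *
            spiral v ((a : ZMod (l.length + r.length)) + (s.1 : ZMod _)) s.2) =
        -(spiral v (a : ZMod (l.length + r.length)) s.1 *
            spiral v ((a : ZMod (l.length + r.length)) + (s.1 : ZMod _)) s.2) := by
      intro s _
      rw [negOnePow_smul_eq_of_ne (m := -1)]
      · simp
      · intro h
        have : spiralDeg l r (a : ZMod (l.length + r.length)) s.1 = 0 := by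
          by_contra h'
          exact h (by rw [spiral_eq_zero hv h', zero_mul])
        rw [this]; rfl
    rw [Finset.sum_congr rfl h4, Finset.sum_neg_distrib, add_neg_eq_zero,
      Finset.Nat.sum_antidiagonal_eq_sum_range_succ_mk, Finset.sum_range_succ] at h3
    rw [h1, h2]
    have h5 : (b - a = l.length + r.length) ↔ b = l.length + r.length + a := by omega
    simp only [h5] at h3
    rw [h3, Nat.sub_self]
    -- The last term of the antidiagonal has a second factor of length `0`.
    have h6 : ∀ z, spiral v z 0 = 0 := fun z => by simp [spiral]
    rw [h6, mul_zero, add_zero]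
    refine Finset.sum_congr rfl fun i _ => ?_
    simp only [coverSpiral, Nat.add_sub_cancel_left, Nat.cast_add]
    congr 2
    omega

theorem spiralLL_zero_apply (p q : Fin l.length) :
    spiralLL (r := r) 0 v p q = coverSpiral v p q := by
  simp [spiralLL, coverSpiral]

theorem spiralLL_one_apply (p q : Fin l.length) :
    spiralLL (r := r) 1 v p q = coverSpiral v p (l.length + r.length + q) := by
  simp [spiralLL, coverSpiral]

theorem spiralLR_apply (p : Fin l.length) (q : Fin r.length) :
    spiralLR v p q = coverSpiral v p (l.length + q) := rfl

theorem spiralRL_apply (p : Fin r.length) (q : Fin l.length) :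
    spiralRL v p q = coverSpiral v (l.length + p) (l.length + r.length + q) := by
  simp only [spiralRL, coverSpiral]
  congr 1
  omega

theorem spiralRR_apply (p q : Fin r.length) :
    spiralRR v p q = coverSpiral v (l.length + p) (l.length + q) := by
  simp only [spiralRR, coverSpiral]
  congr 1
  omega

/-- All five relations are blocks of the identity "square equals translation". The homotopy `S`
consists of the spirals between right half-edges with one additional full turn, as `N` does on the
left. -/
theorem isPassage_spirals (hn : 0 < l.length + r.length)
    (hv : ∀ a i, spiralDeg l r a (i : ℕ+) ≠ 0 → v (a, i) = 0)
    (hD : ∀ a, ∀ i : ℕ+, spiralD l r v a i = 0) :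
    IsPassage (-spiralLL 0 v) (spiralLR v) (spiralRL v) (spiralRR v) (spiralLL 1 v) := by
  have key := @sum_coverSpiral_mul K _ l r v hn hv hD
  have hz : ∀ {a b : ℕ}, b ≤ a → coverSpiral v a b = 0 := coverSpiral_eq_zero v
  have shift := coverSpiral_add v
  refine ⟨?_, ?_, ?_, ?_, Matrix.of fun p q : Fin r.length =>
    coverSpiral v (l.length + p) (l.length + r.length + (l.length + q)), ?_⟩
  · ext p q
    have h := key (a := l.length + p) (b := l.length + q) (N := l.length + r.length) (by omega)
    rw [if_neg (by omega), Finset.sum_range_add, Finset.sum_eq_zero, zero_add] at h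
    · simpa [Matrix.mul_apply, spiralRR_apply, Finset.sum_range] using h
    · intro c hc
      rw [hz (by have := Finset.mem_range.1 hc; omega), zero_mul]
  · ext p q
    have h := key (a := p) (b := l.length + q) (N := l.length + r.length) (by omega)
    rw [if_neg (by omega), Finset.sum_range_add] at h
    rw [Matrix.neg_mul]
    simp only [Matrix.neg_apply, Matrix.mul_apply, spiralRR_apply,
      spiralLL_zero_apply, spiralLR_apply]
    rw [neg_eq_iff_add_eq_zero]
    simpa [Finset.sum_range] using h
  · ext p q
    have h := key (a := l.length + p) (b := l.length + r.length + q)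
      (N := l.length + r.length + l.length) (by omega)
    rw [if_neg (by omega), Finset.sum_range_add, Finset.sum_range_add,
      Finset.sum_eq_zero, zero_add] at h
    · rw [Matrix.mul_neg]
      simp only [Matrix.neg_apply, Matrix.mul_apply, spiralRR_apply,
        spiralLL_zero_apply, spiralRL_apply]
      rw [eq_neg_iff_add_eq_zero]
      simpa [Finset.sum_range, shift] using h
    · intro c hc
      rw [hz (by have := Finset.mem_range.1 hc; omega), zero_mul]
  · ext p q
    have h := key (a := p) (b := l.length + r.length + q)
      (N := l.length + r.length + l.length) (by omega)
    -- The intermediate boundary lies among the left half-edges, the right ones, or the left ones a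
    -- full turn later. The three sums are the entries of `-(a * N)`, `P * Q` and `-(N * a)`.
    rw [Finset.sum_range_add, Finset.sum_range_add] at h
    simp only [Matrix.add_apply, Matrix.neg_mul, Matrix.mul_neg, Matrix.neg_apply,
      Matrix.mul_apply, spiralLR_apply, spiralLL_one_apply, spiralLL_zero_apply, spiralRL_apply,
      Matrix.one_apply]
    simp only [Finset.sum_range, shift, Nat.add_left_cancel_iff, Fin.val_inj, @eq_comm _ q p] at h
    rw [← h]
    ring
  · ext p q
    have h := key (a := l.length + p) (b := l.length + r.length + (l.length + q))
      (N := l.length + r.length + (l.length + r.length)) (by omega)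
    rw [Finset.sum_range_add, Finset.sum_range_add, Finset.sum_range_add, Finset.sum_eq_zero,
      zero_add] at h
    · simp only [Matrix.add_apply, Matrix.mul_apply, Matrix.of_apply, spiralRR_apply,
        spiralRL_apply, spiralLR_apply, Matrix.one_apply]
      simp only [Finset.sum_range, shift, Nat.add_left_cancel_iff, Fin.val_inj,
        @eq_comm _ q p] at h
      rw [← h]
      ring
    · intro c hc
      rw [hz (by have := Finset.mem_range.1 hc; omega), zero_mul]

/-- A change of basis on the entering strands; `C` and `S` do not see it. -/
theorem IsPassage.conj {L M : Type} [Fintype L] [Fintype M] [DecidableEq L] [DecidableEq M]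
    {a : Matrix L L K} {P : Matrix L M K} {Q : Matrix M L K} {C : Matrix M M K}
    {N : Matrix L L K} (h : IsPassage a P Q C N) {T T' : Matrix L L K} (hT : T' * T = 1) :
    IsPassage (T * a * T') (T * P) (Q * T') C (T * N * T') := by
  have hT' : T * T' = 1 := mul_eq_one_comm.1 hT
  have c : ∀ {X : Type} (Y : Matrix L X K), T' * (T * Y) = Y := fun Y => by
    rw [← Matrix.mul_assoc, hT, Matrix.one_mul]
  refine ⟨h.mul_self, ?_, ?_, ?_, ?_⟩
  · rw [Matrix.mul_assoc (T * a), c, Matrix.mul_assoc, h.above, Matrix.mul_assoc]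
  · rw [← Matrix.mul_assoc, h.below]
    simp only [Matrix.mul_assoc, c]
  · have : T * P * (Q * T') = T * (P * Q) * T' := by simp only [Matrix.mul_assoc]
    rw [this, h.left]
    simp only [Matrix.mul_add, Matrix.add_mul, Matrix.mul_assoc, c, Matrix.one_mul, hT']
  · obtain ⟨S, hS⟩ := h.right
    refine ⟨S, ?_⟩
    rw [← hS, Matrix.mul_assoc Q, c]

/-- The spiral count as a number of multiples of the valence. -/
theorem spiralCount_natCast (l r p i : ℕ) :
    spiralCount l r (p : ZMod (l + r)) i =
      (((p + i) / (l + r) + (p + r + i) / (l + r) : ℕ) : ℤ) -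
        ((p / (l + r) + (p + r) / (l + r) : ℕ) : ℤ) := by
  induction i with
  | zero => simp [spiralCount]
  | succ i ih =>
    -- Adding `r` turns congruence to `l` into divisibility by the valence.
    have h1 : ((p : ZMod (l + r)) + (i : ZMod (l + r)) + 1 = (l : ZMod (l + r))) ↔
        l + r ∣ p + r + i + 1 := by
      rw [← ZMod.natCast_eq_zero_iff, ← sub_eq_zero]
      have : ((l : ZMod (l + r)) + (r : ZMod (l + r))) = 0 := by
        rw [← Nat.cast_add, ZMod.natCast_self]
      push_cast
      rw [show ((p : ZMod (l + r)) + r + i + 1) = (p + i + 1 - l) + (l + r) by ring, this,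
        add_zero]
    have h2 : ((p : ZMod (l + r)) + (i : ZMod (l + r)) + 1 = 0) ↔ l + r ∣ p + i + 1 := by
      rw [← ZMod.natCast_eq_zero_iff]
      push_cast
      rfl
    unfold spiralCount at ih ⊢
    rw [Finset.sum_range_succ, ih, ← add_assoc p i 1, ← add_assoc (p + r) i 1, Nat.succ_div,
      Nat.succ_div]
    simp only [h1, h2]
    split_ifs <;> push_cast <;> ring

theorem halfEdgePotential_left (p : Fin l.length) (r : List ℤ) :
    halfEdgePotential l r ((p : ℕ) : ZMod (l.length + r.length)) = l.get p := by
  rw [halfEdgePotential, ZMod.val_natCast_of_lt (by omega), List.getD_append _ _ _ _ p.2]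
  simp

theorem halfEdgePotential_right (l : List ℤ) (p : Fin r.length) :
    halfEdgePotential l r ((l.length + (p : ℕ) : ℕ) : ZMod (l.length + r.length)) = r.get p := by
  rw [halfEdgePotential, ZMod.val_natCast_of_lt (by omega),
    List.getD_append_right _ _ _ _ (by omega)]
  simp

theorem halfEdgePotential_add (l r : List ℤ) (p : ℕ) :
    halfEdgePotential l r ((l.length + r.length + p : ℕ) : ZMod (l.length + r.length)) =
      halfEdgePotential l r (p : ZMod (l.length + r.length)) := by
  rw [Nat.cast_add, ZMod.natCast_self, zero_add]

/-! ### Potentials at the ends of spirals of degree zero -/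

section Degrees

/-- How often the line through a vertex of type `(l, r)` is met up to a point of the universal
cover. -/
def lineCount (l r b : ℕ) : ℕ := b / (l + r) + (b + r) / (l + r)

theorem lineCount_left {l r p : ℕ} (hp : p < l) : lineCount l r p = 0 := by
  rw [lineCount, Nat.div_eq_of_lt (by omega), Nat.div_eq_of_lt (by omega)]

theorem lineCount_right {l r p : ℕ} (hp : p < r) : lineCount l r (l + p) = 1 := by
  rw [lineCount, Nat.div_eq_of_lt (by omega), Nat.div_eq_of_lt_le (k := 1) (by omega) (by omega)]

theorem lineCount_add {l r p : ℕ} (hn : 0 < l + r) :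
    lineCount l r (l + r + p) = lineCount l r p + 2 := by
  rw [lineCount, lineCount, Nat.add_div_left _ hn, add_assoc (l + r), Nat.add_div_left _ hn]
  omega

/-- Degree `0` says that the potential drops by `1` minus the number of times the line is met. Thus
the blocks without, with one, and with two such points have degree `1`, `0` and `-1`. -/
theorem potential_of_coverSpiral_ne_zero
    (hv : ∀ a i, spiralDeg l r a (i : ℕ+) ≠ 0 → v (a, i) = 0) {a b : ℕ}
    (h : coverSpiral v a b ≠ 0) :
    halfEdgePotential l r (a : ZMod (l.length + r.length)) =
      halfEdgePotential l r (b : ZMod (l.length + r.length)) + lineCount l.length r.length a -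
        lineCount l.length r.length b + 1 := by
  have hab : a < b := by
    by_contra h'
    exact h (coverSpiral_eq_zero v (not_lt.1 h'))
  have h0 : spiralDeg l r (a : ZMod (l.length + r.length)) (b - a) = 0 := by
    by_contra h'
    exact h (spiral_eq_zero hv h')
  rw [spiralDeg, spiralCount_natCast, ← Nat.cast_add,
    Nat.add_sub_cancel' hab.le, show a + r.length + (b - a) = b + r.length by omega] at h0
  unfold lineCount
  linarith

theorem potential_of_spiralLL_zero_ne_zero
    (hv : ∀ a i, spiralDeg l r a (i : ℕ+) ≠ 0 → v (a, i) = 0) {p q : Fin l.length}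
    (h : spiralLL (r := r) 0 v p q ≠ 0) : l.get p = l.get q + 1 := by
  rw [spiralLL_zero_apply] at h
  have h0 := potential_of_coverSpiral_ne_zero hv h
  rw [halfEdgePotential_left, halfEdgePotential_left, lineCount_left p.2,
    lineCount_left q.2] at h0
  push_cast at h0; linarith

theorem potential_of_spiralLL_one_ne_zero (hn : 0 < l.length + r.length)
    (hv : ∀ a i, spiralDeg l r a (i : ℕ+) ≠ 0 → v (a, i) = 0) {p q : Fin l.length}
    (h : spiralLL (r := r) 1 v p q ≠ 0) : l.get p = l.get q - 1 := by
  rw [spiralLL_one_apply] at h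
  have h0 := potential_of_coverSpiral_ne_zero hv h
  rw [halfEdgePotential_add, halfEdgePotential_left, halfEdgePotential_left, lineCount_left p.2,
    lineCount_add hn, lineCount_left q.2] at h0
  push_cast at h0; linarith

theorem potential_of_spiralLR_ne_zero
    (hv : ∀ a i, spiralDeg l r a (i : ℕ+) ≠ 0 → v (a, i) = 0) {p : Fin l.length}
    {q : Fin r.length} (h : spiralLR v p q ≠ 0) : l.get p = r.get q := by
  rw [spiralLR_apply] at h
  have h0 := potential_of_coverSpiral_ne_zero hv h
  rw [halfEdgePotential_left, halfEdgePotential_right, lineCount_left p.2,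
    lineCount_right q.2] at h0
  push_cast at h0; linarith

theorem potential_of_spiralRL_ne_zero (hn : 0 < l.length + r.length)
    (hv : ∀ a i, spiralDeg l r a (i : ℕ+) ≠ 0 → v (a, i) = 0) {p : Fin r.length}
    {q : Fin l.length} (h : spiralRL v p q ≠ 0) : r.get p = l.get q := by
  rw [spiralRL_apply] at h
  have h0 := potential_of_coverSpiral_ne_zero hv h
  rw [halfEdgePotential_add, halfEdgePotential_left, halfEdgePotential_right,
    lineCount_add hn, lineCount_left q.2, lineCount_right p.2] at h0
  push_cast at h0; linarith

theorem potential_of_spiralRR_ne_zero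
    (hv : ∀ a i, spiralDeg l r a (i : ℕ+) ≠ 0 → v (a, i) = 0) {p q : Fin r.length}
    (h : spiralRR v p q ≠ 0) : r.get p = r.get q + 1 := by
  rw [spiralRR_apply] at h
  have h0 := potential_of_coverSpiral_ne_zero hv h
  rw [halfEdgePotential_right, halfEdgePotential_right, lineCount_right p.2,
    lineCount_right q.2] at h0
  push_cast at h0; linarith

end Degrees

end Spiral

/-!
### The half twist of a vertex
-/

/-- A matrix between lists of potentials whose entries all have degree `k`. -/
def IsHomogeneous {K : Type*} [Zero K] (μ ν : List ℤ) (k : ℤ)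
    (A : Matrix (Fin μ.length) (Fin ν.length) K) : Prop :=
  ∀ i j, A i j ≠ 0 → μ.get i = ν.get j + k

theorem IsHomogeneous.mul {K : Type*} [Field K] {μ ν ρ : List ℤ} {k m : ℤ}
    {A : Matrix (Fin μ.length) (Fin ν.length) K} {B : Matrix (Fin ν.length) (Fin ρ.length) K}
    (hA : IsHomogeneous μ ν k A) (hB : IsHomogeneous ν ρ m B) :
    IsHomogeneous μ ρ (k + m) (A * B) := by
  intro i j h
  rw [Matrix.mul_apply] at h
  obtain ⟨c, -, hc⟩ := Finset.exists_ne_zero_of_sum_ne_zero h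
  rw [hA i c (left_ne_zero_of_mul hc), hB c j (right_ne_zero_of_mul hc)]
  ring

section Twist

variable {K : Type*} [Field K] {l : List ℤ} {c : Chord l.length → K}

theorem isHomogeneous_twistAbove (hc : ∀ k, l.get k.1.1 - l.get k.1.2 ≠ 0 → c k = 0) :
    IsHomogeneous l l 0 (twistAbove c) := by
  intro i j h
  by_contra h'
  have hij : i ≠ j := by rintro rfl; simp at h'
  apply h
  rw [twistAbove, Matrix.add_apply, Matrix.one_apply_ne hij, zero_add, chordMatrix]
  split_ifs
  · exact hc _ (by simpa [sub_eq_zero] using h')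
  · rfl

/-- Each factor raises the index by at least `1`. -/
theorem chordMatrix_pow_eq_zero {n : ℕ} (c : Chord n → K) : chordMatrix c ^ n = 0 := by
  have h : ∀ m : ℕ, ∀ i j : Fin n, (j : ℕ) < i + m → (chordMatrix c ^ m) i j = 0 := by
    intro m
    induction m with
    | zero =>
      intro i j hij
      rw [pow_zero, Matrix.one_apply_ne]
      rintro rfl
      omega
    | succ m ih =>
      intro i j hij
      rw [pow_succ, Matrix.mul_apply]
      refine Finset.sum_eq_zero fun k _ => ?_
      rcases lt_or_ge (k : ℕ) (i + m) with hk | hk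
      · rw [ih i k hk, zero_mul]
      · rw [chordMatrix, dif_neg, mul_zero]
        rw [Fin.lt_def]
        omega
  ext i j
  exact h n i j (by omega)

theorem twistBelow_eq (hc : ∀ k, l.get k.1.1 - l.get k.1.2 ≠ 0 → c k = 0) :
    twistBelow c = ∑ m ∈ Finset.range l.length, (-chordMatrix c) ^ m := by
  refine Finset.sum_congr rfl fun m _ => congrArg (· ^ m) ?_
  ext i j
  rw [Matrix.neg_apply, chordMatrix, chordMatrix]
  split_ifs with h
  · rw [negOnePow_smul_eq_of_ne (m := -1)]
    · simp
    · intro h'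
      have : l.get i - l.get j = 0 := by
        by_contra h''
        exact h' (hc ⟨(i, j), h⟩ h'')
      rw [this]; rfl
  · simp

/-- Under an augmentation the lower boundary is the geometric series of `(1 + c)⁻¹`, which is finite
because `c` is nilpotent. -/
theorem twistBelow_mul_twistAbove (hc : ∀ k, l.get k.1.1 - l.get k.1.2 ≠ 0 → c k = 0) :
    twistBelow c * twistAbove c = 1 := by
  have h := geom_sum_mul_neg (-chordMatrix c) l.length
  rw [neg_pow, chordMatrix_pow_eq_zero, mul_zero, sub_zero, sub_neg_eq_add] at h
  rw [twistBelow_eq hc, twistAbove, h]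

theorem isHomogeneous_twistBelow (hc : ∀ k, l.get k.1.1 - l.get k.1.2 ≠ 0 → c k = 0) :
    IsHomogeneous l l 0 (twistBelow c) := by
  have h1 : IsHomogeneous l l 0 (-chordMatrix c) := by
    intro i j h
    by_contra h'
    apply h
    rw [Matrix.neg_apply, chordMatrix]
    split_ifs
    · rw [hc _ (by simpa [sub_eq_zero] using h'), neg_zero]
    · exact neg_zero
  have h2 : ∀ m : ℕ, IsHomogeneous l l 0 ((-chordMatrix c) ^ m) := by
    intro m
    induction m with
    | zero =>
      intro i j h
      by_contra h'
      refine h (Matrix.one_apply_ne ?_)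
      rintro rfl
      simp at h'
    | succ m ih =>
      rw [pow_succ]
      simpa using ih.mul h1
  rw [twistBelow_eq hc]
  intro i j h
  rw [Matrix.sum_apply] at h
  obtain ⟨m, -, hm⟩ := Finset.exists_ne_zero_of_sum_ne_zero h
  exact h2 m i j hm

end Twist

/-!
### The passages of a piece
-/

section Passage

variable {K : Type*} [Field K] {l r : List ℤ}

theorem Piece.isHomogeneous_fromAbove (E : Piece l r) {x : E.Gen → K} (t : E.Base → Kˣ)
    (hx : ∀ g, E.deg g ≠ 0 → x g = 0) : IsHomogeneous l r 0 (E.fromAbove x t) := by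
  cases E with
  | leftCusp => exact fun i j h => absurd rfl h
  | rightCusp => exact fun i j h => absurd rfl h
  | crossing p q =>
    intro i j h
    have h0 : x () ≠ 0 → p = q := fun h => by
      by_contra h'
      exact h (hx () (sub_ne_zero.2 h'))
    fin_cases i <;> fin_cases j <;> simp [Piece.fromAbove] at h ⊢
    exact h0 h
  | basePoint p => intro i j h; fin_cases i; fin_cases j; simp
  | vertex l r hn =>
    have h1 : IsHomogeneous l l 0 (twistAbove (x ∘ Sum.inl)) :=
      isHomogeneous_twistAbove fun k hk => hx (.inl k) hk
    have h2 : IsHomogeneous l r 0 (spiralLR (x ∘ Sum.inr)) := fun i j h => by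
      rw [add_zero]
      exact potential_of_spiralLR_ne_zero (fun a i hi => hx (.inr (a, i)) hi) h
    exact h1.mul h2

theorem Piece.isHomogeneous_toBelow (E : Piece l r) {x : E.Gen → K} (t : E.Base → Kˣ)
    (hx : ∀ g, E.deg g ≠ 0 → x g = 0) : IsHomogeneous r l 0 (E.toBelow x t) := by
  cases E with
  | leftCusp => exact fun i j h => absurd rfl h
  | rightCusp => exact fun i j h => absurd rfl h
  | crossing p q =>
    intro i j h
    have h0 : x () ≠ 0 → p = q := fun h => by
      by_contra h'
      exact h (hx () (sub_ne_zero.2 h'))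
    fin_cases i <;> fin_cases j <;> simp [Piece.toBelow] at h ⊢
    exact h0 (fun h' => h (by rw [h', smul_zero]))
  | basePoint p => intro i j h; fin_cases i; fin_cases j; simp
  | vertex l r hn =>
    have h1 : IsHomogeneous l l 0 (twistBelow (x ∘ Sum.inl)) :=
      isHomogeneous_twistBelow fun k hk => hx (.inl k) hk
    have h2 : IsHomogeneous r l 0 (spiralRL (x ∘ Sum.inr)) := fun i j h => by
      rw [add_zero]
      exact potential_of_spiralRL_ne_zero hn (fun a i hi => hx (.inr (a, i)) hi) h
    exact h2.mul h1

theorem Piece.isHomogeneous_closed (E : Piece l r) {x : E.Gen → K} (t : E.Base → Kˣ)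
    (hx : ∀ g, E.deg g ≠ 0 → x g = 0) : IsHomogeneous r r 1 (E.closed x t) := by
  cases E with
  | leftCusp b m =>
    intro i j h
    fin_cases i <;> fin_cases j <;> simp [Piece.closed] at h ⊢
  | rightCusp => exact fun i j h => absurd rfl h
  | crossing p q => exact fun i j h => absurd rfl h
  | basePoint p => exact fun i j h => absurd rfl h
  | vertex l r hn =>
    exact fun i j h =>
      potential_of_spiralRR_ne_zero (fun a i hi => hx (.inr (a, i)) hi) h

/-- The kink crossing has degree `1`, so an augmentation leaves only the straight path through the
loop. -/
theorem Piece.around_rightCusp {b : Bool} {m : ℤ} {x : (rightCusp b m).Gen → K}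
    (t : (rightCusp b m).Base → Kˣ) (hx : x () = 0) :
    (rightCusp b m).around x t = !![0, 0; (((cuspUnit t)⁻¹ : Kˣ) : K), 0] := by
  ext i j
  fin_cases i <;> fin_cases j <;> simp [Piece.around, hx]

theorem Piece.isHomogeneous_around (E : Piece l r) {x : E.Gen → K} (t : E.Base → Kˣ)
    (hx : ∀ g, E.deg g ≠ 0 → x g = 0) : IsHomogeneous l l (-1) (E.around x t) := by
  cases E with
  | leftCusp => exact fun i j h => absurd rfl h
  | rightCusp b m =>
    rw [around_rightCusp t (hx () one_ne_zero)]
    intro i j h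
    fin_cases i <;> fin_cases j <;> simp at h ⊢
  | crossing p q => exact fun i j h => absurd rfl h
  | basePoint p => exact fun i j h => absurd rfl h
  | vertex l r hn =>
    have h1 : IsHomogeneous l l 0 (twistAbove (x ∘ Sum.inl)) :=
      isHomogeneous_twistAbove fun k hk => hx (.inl k) hk
    have h2 : IsHomogeneous l l 0 (twistBelow (x ∘ Sum.inl)) :=
      isHomogeneous_twistBelow fun k hk => hx (.inl k) hk
    have h3 : IsHomogeneous l l (-1) (spiralLL (r := r) 1 (x ∘ Sum.inr)) := fun i j h =>
      potential_of_spiralLL_one_ne_zero hn (fun a i hi => hx (.inr (a, i)) hi) h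
    exact (h1.mul h3).mul h2

theorem Piece.isPassage (E : Piece l r) {x : E.Gen → K} {t : E.Base → Kˣ}
    (hx : ∀ g, E.deg g ≠ 0 → x g = 0) {a : Matrix (Fin l.length) (Fin l.length) K}
    (ha : ∀ i j, j ≤ i → a i j = 0) (hd : ∀ g, E.d a x t g = 0) :
    IsPassage a (E.fromAbove x t) (E.toBelow x t) (E.closed x t) (E.around x t) := by
  cases E with
  | leftCusp b m =>
    -- The two new strands form a contractible complex; inverting the cusp unit contracts it.
    refine ⟨?_, ?_, ?_, ?_, !![0, 0; (((cuspUnit t)⁻¹ : Kˣ) : K), 0], ?_⟩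
    · ext i j
      fin_cases i <;> fin_cases j <;> simp [Piece.closed]
    · ext i; exact i.elim0
    · ext i j; exact j.elim0
    · ext i; exact i.elim0
    · ext i j
      fin_cases i <;> fin_cases j <;> simp [Piece.closed, Piece.toBelow]
  | rightCusp b m =>
    have h01 : a 0 1 = -((cuspUnit t : Kˣ) : K) := eq_neg_of_add_eq_zero_left (hd ())
    have h : a = !![0, -((cuspUnit t : Kˣ) : K); 0, 0] := by
      ext i j
      fin_cases i <;> fin_cases j
      · exact ha _ _ le_rfl
      · exact h01
      · exact ha _ _ (by simp)
      · exact ha _ _ le_rfl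
    rw [around_rightCusp t (hx () one_ne_zero), h]
    refine ⟨?_, ?_, ?_, ?_, 0, ?_⟩
    · ext i; exact i.elim0
    · ext i j; exact j.elim0
    · ext i; exact i.elim0
    · ext i j
      fin_cases i <;> fin_cases j <;> simp [Piece.fromAbove, Piece.toBelow]
    · ext i; exact i.elim0
  | crossing p q =>
    -- The only entry above the diagonal is the differential of the crossing.
    have h : a = 0 := by
      ext i j
      fin_cases i <;> fin_cases j
      · exact ha _ _ le_rfl
      · exact hd ()
      · exact ha _ _ (by simp)
      · exact ha _ _ le_rfl
    have hs : (p - q - 1).negOnePow • x () = -x () := by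
      rw [negOnePow_smul_eq_of_ne (m := -1)]
      · simp
      · intro h
        have : p - q = 0 := by
          by_contra h'
          exact h (hx () h')
        rw [this]; rfl
    rw [h]
    refine ⟨by simp [Piece.closed], by simp [Piece.closed], by simp [Piece.closed], ?_, 0, ?_⟩
    · ext i j
      fin_cases i <;> fin_cases j <;> simp [Piece.fromAbove, Piece.toBelow, hs]
    · ext i j
      fin_cases i <;> fin_cases j <;> simp [Piece.fromAbove, Piece.toBelow, hs]
  | basePoint p =>
    have h : a = 0 := by
      ext i j
      exact ha _ _ (le_of_eq (Subsingleton.elim (α := Fin 1) _ _))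
    rw [h]
    refine ⟨by simp [Piece.closed], by simp [Piece.closed], by simp [Piece.closed], ?_, 0, ?_⟩
    · ext i j
      fin_cases i; fin_cases j; simp [Piece.fromAbove, Piece.toBelow]
    · ext i j
      fin_cases i; fin_cases j; simp [Piece.fromAbove, Piece.toBelow]
  | vertex l r hn =>
    have hc : ∀ k : Chord l.length, l.get k.1.1 - l.get k.1.2 ≠ 0 → (x ∘ Sum.inl) k = 0 :=
      fun k hk => hx (.inl k) hk
    have hv : ∀ b i, spiralDeg l r b (i : ℕ+) ≠ 0 → (x ∘ Sum.inr) (b, i) = 0 :=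
      fun b i hi => hx (.inr (b, i)) hi
    have hT := twistBelow_mul_twistAbove hc
    have hT' := mul_eq_one_comm.1 hT
    have hT0 : ∀ {i j}, j < i → twistAbove (x ∘ Sum.inl) i j = 0 := fun {i j} hij => by
      rw [twistAbove, Matrix.add_apply, Matrix.one_apply_ne hij.ne', chordMatrix,
        dif_neg hij.not_gt, add_zero]
    have hF0 : ∀ {i j}, j ≤ i → spiralLL (r := r) 0 (x ∘ Sum.inr) i j = 0 := fun {i j} hij => by
      rw [spiralLL_zero_apply, coverSpiral_eq_zero _ hij]
    have hF : IsHomogeneous l l 1 (spiralLL (r := r) 0 (x ∘ Sum.inr)) := fun i j h =>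
      potential_of_spiralLL_zero_ne_zero hv h
    -- Above the diagonal this is `∂ c = 0` for the crossings of the half twist; elsewhere both
    -- sides vanish by triangularity. The sign is `+1` here because the product has degree `1`.
    have h : a * twistAbove (x ∘ Sum.inl) =
        -(twistAbove (x ∘ Sum.inl) * spiralLL (r := r) 0 (x ∘ Sum.inr)) := by
      ext i j
      rcases lt_or_ge i j with hij | hij
      · have h1 : (a * twistAbove (x ∘ Sum.inl)) i j + (l.get i - l.get j - 1).negOnePow •
            (twistAbove (x ∘ Sum.inl) * spiralLL (r := r) 0 (x ∘ Sum.inr)) i j = 0 :=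
          hd (.inl ⟨(i, j), hij⟩)
        rw [negOnePow_smul_eq_of_ne (m := 0), Int.negOnePow_zero, one_smul] at h1
        · exact eq_neg_of_add_eq_zero_left h1
        · intro h2
          rw [((isHomogeneous_twistAbove hc).mul hF) i j h2]
          ring
      · rw [Matrix.neg_apply, Matrix.mul_apply, Matrix.mul_apply, Finset.sum_eq_zero,
          Finset.sum_eq_zero, neg_zero]
        · intro k _
          rcases lt_or_ge k i with hk | hk
          · rw [hT0 hk, zero_mul]
          · rw [hF0 (hij.trans hk), mul_zero]
        · intro k _
          rcases le_or_gt k i with hk | hk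
          · rw [ha i k hk, zero_mul]
          · rw [hT0 (hij.trans_lt hk), mul_zero]
    have ha' : a = twistAbove (x ∘ Sum.inl) * -spiralLL (r := r) 0 (x ∘ Sum.inr) *
        twistBelow (x ∘ Sum.inl) := by
      rw [Matrix.mul_neg, ← h, Matrix.mul_assoc, hT', Matrix.mul_one]
    rw [ha']
    exact (isPassage_spirals hn hv fun b i => hd (.inr (b, i))).conj hT

end Passage

/-!
### Half-disk counts of an augmentation
-/

section Field

variable {K : Type*} [Field K] {μL μR : List ℤ}

theorem isHomogeneous_chordMatrix {μ : List ℤ} {x : Chord μ.length → K}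
    (hx : ∀ k, chordDeg μ k ≠ 0 → x k = 0) : IsHomogeneous μ μ 1 (chordMatrix x) := by
  intro i j h
  unfold chordMatrix at h
  split_ifs at h with hij
  · by_contra h'
    refine h (hx _ fun h0 => h' ?_)
    unfold chordDeg at h0
    linarith
  · exact absurd rfl h

/-- Factors `k_{ac}` that survive have degree `0`, so the augmentation equation of a border DGA is
`A * A = 0`. -/
theorem chordD_eq_neg_mul {μ : List ℤ} {x : Chord μ.length → K}
    (hx : ∀ k, chordDeg μ k ≠ 0 → x k = 0) (k : Chord μ.length) :
    chordD μ x k = -(chordMatrix x * chordMatrix x) k.1.1 k.1.2 := by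
  rw [chordD, Matrix.mul_apply, ← Finset.sum_neg_distrib]
  refine Finset.sum_congr rfl fun c _ => ?_
  rw [negOnePow_smul_eq_of_ne (m := -1)]
  · simp
  · intro h
    rw [isHomogeneous_chordMatrix hx _ _ (left_ne_zero_of_mul h)]
    ring

theorem Front.isHomogeneous_halfDisks (T : Front μL μR) {x : T.Gen → K} (t : T.Base → Kˣ)
    (hx : ∀ g, T.deg g ≠ 0 → x g = 0) : IsHomogeneous μR μR 1 (T.halfDisks x t) := by
  induction T with
  | trivial => exact isHomogeneous_chordMatrix hx
  | concat u w T E ih =>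
    rename_i l r
    have ih := ih (x := x ∘ Sum.inl) (t ∘ Sum.inl) fun g hg => hx (.inl g) hg
    have hE : ∀ g, E.deg g ≠ 0 → (x ∘ Sum.inr) g = 0 := fun g hg => hx (.inr g) hg
    have hP := E.isHomogeneous_fromAbove (t ∘ Sum.inr) hE
    have hQ := E.isHomogeneous_toBelow (t ∘ Sum.inr) hE
    have hC := E.isHomogeneous_closed (t ∘ Sum.inr) hE
    have hN := E.isHomogeneous_around (t ∘ Sum.inr) hE
    intro i j h
    obtain ⟨i, rfl⟩ := (blocks u r w).symm.surjective i
    obtain ⟨j, rfl⟩ := (blocks u r w).symm.surjective j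
    simp only [Front.halfDisks, Matrix.reindex_apply, Matrix.submatrix_apply, Equiv.symm_symm,
      Equiv.apply_symm_apply] at h
    have key : ∀ i j, T.halfDisks (x ∘ Sum.inl) (t ∘ Sum.inl) ((blocks u l w).symm i)
        ((blocks u l w).symm j) ≠ 0 → (u ++ (l ++ w)).get ((blocks u l w).symm i) =
          (u ++ (l ++ w)).get ((blocks u l w).symm j) + 1 := fun i j => ih _ _
    rcases i with i | i | i <;> rcases j with j | j | j <;>
      simp only [sweep, Matrix.submatrix_apply, ne_eq, not_true_eq_false] at h
    · simpa only [get_blocks_symm_inl] using key (.inl i) (.inl j) h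
    · obtain ⟨p, -, hp⟩ := Finset.exists_ne_zero_of_sum_ne_zero h
      have h1 := key _ _ (left_ne_zero_of_mul hp)
      have h2 := hP _ _ (right_ne_zero_of_mul hp)
      simp only [get_blocks_symm_inl, get_blocks_symm_inr_inl] at h1 ⊢
      linarith
    -- The detour around the piece has degree `1 - 1 + 1 = 1`, like the direct term.
    · simp only [get_blocks_symm_inl, get_blocks_symm_inr_inr]
      by_cases h0 : T.halfDisks (x ∘ Sum.inl) (t ∘ Sum.inl) ((blocks u l w).symm (.inl i))
        ((blocks u l w).symm (.inr (.inr j))) = 0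
      · rw [h0, zero_add] at h
        obtain ⟨p, -, hp⟩ := Finset.exists_ne_zero_of_sum_ne_zero h
        obtain ⟨q, -, hq⟩ := Finset.exists_ne_zero_of_sum_ne_zero hp
        have h1 := key _ _ (left_ne_zero_of_mul (left_ne_zero_of_mul hq))
        have h2 := hN _ _ (right_ne_zero_of_mul (left_ne_zero_of_mul hq))
        have h3 := key _ _ (right_ne_zero_of_mul hq)
        simp only [get_blocks_symm_inl, get_blocks_symm_inr_inl,
          get_blocks_symm_inr_inr] at h1 h3
        linarith
      · simpa only [get_blocks_symm_inl, get_blocks_symm_inr_inr] using key _ _ h0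
    · have h1 := hC _ _ h
      simpa only [get_blocks_symm_inr_inl] using h1
    · obtain ⟨p, -, hp⟩ := Finset.exists_ne_zero_of_sum_ne_zero h
      have h1 := hQ _ _ (left_ne_zero_of_mul hp)
      have h2 := key _ _ (right_ne_zero_of_mul hp)
      simp only [get_blocks_symm_inr_inl, get_blocks_symm_inr_inr] at h2 ⊢
      linarith
    · simpa only [get_blocks_symm_inr_inr] using key _ _ h

theorem Front.exactSquareZero_halfDisks (T : Front μL μR) {x : T.Gen → K} {t : T.Base → Kˣ}
    (hx : ∀ g, T.deg g ≠ 0 → x g = 0) (hd : ∀ g, T.genD x t g = 0)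
    (hL : ∀ z, z ᵥ* chordMatrix (x ∘ T.leftGen) = 0 →
      ∃ y, z = y ᵥ* chordMatrix (x ∘ T.leftGen)) :
    ExactSquareZero (T.halfDisks x t) := by
  induction T with
  | trivial =>
    refine ⟨?_, hL⟩
    ext i j
    rcases lt_or_ge i j with hij | hij
    · have h1 := hd ⟨(i, j), hij⟩
      simp only [Front.genD] at h1
      rw [chordD_eq_neg_mul hx, neg_eq_zero] at h1
      exact h1
    · rw [Matrix.mul_apply, Finset.sum_eq_zero, Matrix.zero_apply]
      intro k _
      rcases le_or_gt k i with hk | hk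
      · rw [Front.halfDisks_eq_zero _ _ _ hk, zero_mul]
      · rw [Front.halfDisks_eq_zero _ _ _ (hij.trans hk.le), mul_zero]
  | concat u w T E ih =>
    rename_i l r
    have ih := ih (x := x ∘ Sum.inl) (t := t ∘ Sum.inl) (fun g hg => hx (.inl g) hg)
      (fun g => hd (.inl g)) hL
    have h0 : ∀ {i j}, j ≤ i → T.halfDisks (x ∘ Sum.inl) (t ∘ Sum.inl) i j = 0 :=
      fun hij => T.halfDisks_eq_zero _ _ hij
    have hP := E.isPassage (x := x ∘ Sum.inr) (t := t ∘ Sum.inr) (fun g hg => hx (.inr g) hg)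
      (a := fun p q => T.halfDisks (x ∘ Sum.inl) (t ∘ Sum.inl)
        ((blocks u l w).symm (.inr (.inl p))) ((blocks u l w).symm (.inr (.inl q))))
      (fun i j hij => h0 (by
        rw [Fin.le_def, blocks_symm_inr_inl, blocks_symm_inr_inl]; simpa using hij))
      (fun g => hd (.inr g))
    simp only [Front.halfDisks]
    refine ExactSquareZero.reindex ?_ _
    have h1 := ih.reindex (blocks u l w)
    set A := Matrix.reindex (blocks u l w) (blocks u l w)
      (T.halfDisks (x ∘ Sum.inl) (t ∘ Sum.inl)) with hA
    -- Triangularity of the counts kills the three blocks below the diagonal.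
    have h2 : A = blockTri (fun i j => A (.inl i) (.inl j)) (fun i j => A (.inl i) (.inr (.inl j)))
        (fun i j => A (.inl i) (.inr (.inr j))) (fun i j => A (.inr (.inl i)) (.inr (.inl j)))
        (fun i j => A (.inr (.inl i)) (.inr (.inr j)))
        (fun i j => A (.inr (.inr i)) (.inr (.inr j))) := by
      ext (i | i | i) (j | j | j)
      case inr.inl.inl | inr.inr.inl | inr.inr.inr.inl =>
        refine h0 ?_
        simp only [Fin.le_def, blocks_symm_inl, blocks_symm_inr_inl, blocks_symm_inr_inr]
        omega
      all_goals rfl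
    rw [h2] at h1 ⊢
    exact h1.sweep hP

end Field

/-!
### Augmentations
-/

section Augmentation

variable {K : Type*} [Field K]

/-- A ring homomorphism that annihilates the differentials of the generators annihilates all
differentials. -/
theorem map_differential_eq_zero {R X : Type} [CommRing R] {deg : X → ℤ}
    {d : X → FreeAlgebra R X} {ε : FreeAlgebra R X →+* K} (h : ∀ x, ε (d x) = 0)
    (a : FreeAlgebra R X) : ε (differential deg d a) = 0 := by
  induction a using FreeAlgebra.induction with
  | grade0 r => simp [differential, Matrix.algebraMap_matrix_apply]
  | grade1 x => rw [differential_ι, h]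
  | mul a b ha hb => rw [differential_mul, map_add, map_mul, map_mul, ha, hb]; simp
  | add a b ha hb => rw [map_add, map_add, ha, hb, add_zero]

/-- The Morse differential is `A` preceded by the diagonal matrix of signs `(-1)^{μ(a)}`. As `A`
lowers the potential by `1`, it anticommutes with these signs, so they change neither kernel nor
range. -/
theorem isAcyclic_iff {μ : List ℤ} {ε : BorderAlg μ →+* K} {A : Matrix _ _ K}
    (hA : chordMatrix (fun k => ε (FreeAlgebra.ι ℤ k)) = A) (hμ : IsHomogeneous μ μ 1 A) :
    IsAcyclic μ ε ↔ ∀ z, z ᵥ* A = 0 ↔ ∃ y, z = y ᵥ* A := by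
  have hs : ∀ z, morse μ ε z = fun b => ((fun a => (μ.get a).negOnePow • z a) ᵥ* A) b := by
    intro z
    funext b
    simp only [morse, hA, Matrix.toLin'_apply, Matrix.mulVec, dotProduct, Matrix.vecMul,
      Matrix.of_apply]
    refine Finset.sum_congr rfl fun a _ => ?_
    rw [smul_mul_assoc, smul_mul_assoc, mul_comm]
  have hs' : ∀ z : Fin μ.length → K, ((fun a => (μ.get a).negOnePow • z a) ᵥ* A) =
      fun b => -((μ.get b).negOnePow • (z ᵥ* A) b) := by
    intro z
    funext b
    simp only [Matrix.vecMul, dotProduct, Finset.smul_sum, ← Finset.sum_neg_distrib]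
    refine Finset.sum_congr rfl fun a _ => ?_
    rw [smul_mul_assoc, negOnePow_smul_eq_of_ne (m := μ.get b + 1), Int.negOnePow_succ]
    · simp
    · exact fun h => hμ _ _ (right_ne_zero_of_mul h)
  have hss : ∀ z : Fin μ.length → K,
      (fun a => (μ.get a).negOnePow • (fun a => (μ.get a).negOnePow • z a) a) = z := by
    intro z
    funext a
    simp [smul_smul]
  have hker : ∀ z, z ∈ LinearMap.ker (morse μ ε) ↔ z ᵥ* A = 0 := by
    intro z
    rw [LinearMap.mem_ker, hs, hs']
    constructor <;> intro h
    · funext b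
      have h1 := congrFun h b
      rwa [Pi.zero_apply, neg_eq_zero, smul_eq_zero_iff_eq] at h1
    · simp [h]; rfl
  have hran : ∀ z, z ∈ LinearMap.range (morse μ ε) ↔ ∃ y, z = y ᵥ* A := by
    intro z
    constructor
    · rintro ⟨y, rfl⟩
      exact ⟨_, hs y⟩
    · rintro ⟨y, rfl⟩
      refine ⟨fun a => (μ.get a).negOnePow • y a, ?_⟩
      rw [hs, hss]
  simp only [← hker, ← hran]
  exact Submodule.ext_iff

end Augmentation

theorem Front.deg_leftGen {μL μR : List ℤ} (T : Front μL μR) (k : Chord μL.length) :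
    T.deg (T.leftGen k) = chordDeg μL k := by
  induction T with
  | trivial => rfl
  | concat u w T E ih => exact ih

end LegendrianGraph

open LegendrianGraph in
theorem mainTheorem9 {K : Type*} [Field K] {μL μR : List ℤ} (T : Front μL μR)
    (ε : T.Alg →+* K) (hε : IsAugmentation T.deg T.d ε)
    (hL : IsAcyclic μL (ε.comp T.phiL)) :
    IsAugmentation (chordDeg μR) (borderD μR) (ε.comp T.phiR) ∧
      IsAcyclic μR (ε.comp T.phiR) := by
  set t : T.Base → Kˣ := Units.map (ε : T.Alg →* K) ∘ T.t with ht
  have hx : ∀ g, T.deg g ≠ 0 → (ε ∘ T.x) g = 0 := hε.1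
  have hd : ∀ g, T.genD (ε ∘ T.x) t g = 0 := fun g => by
    rw [ht, ← Front.map_genD]
    have h := hε.2 (FreeAlgebra.ι _ g)
    rwa [differential_ι] at h
  have hLmat : chordMatrix (fun k => (ε.comp T.phiL) (FreeAlgebra.ι ℤ k)) =
      chordMatrix ((ε ∘ T.x) ∘ T.leftGen) := by
    congr 1
    funext k
    simp [Front.phiL]
  have hLhom : IsHomogeneous μL μL 1 (chordMatrix ((ε ∘ T.x) ∘ T.leftGen)) :=
    isHomogeneous_chordMatrix fun k hk => hx _ (by rwa [T.deg_leftGen])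
  have hA := T.exactSquareZero_halfDisks hx hd
    fun z => (((isAcyclic_iff hLmat hLhom).1 hL) z).1
  have hhom := T.isHomogeneous_halfDisks t hx
  have hR : ∀ k : Chord μR.length, (ε.comp T.phiR) (FreeAlgebra.ι ℤ k) =
      T.halfDisks (ε ∘ T.x) t k.1.1 k.1.2 := fun k => by
    rw [ht, ← Front.map_halfDisks]
    simp [Front.phiR]
  have hRmat : chordMatrix (fun k => (ε.comp T.phiR) (FreeAlgebra.ι ℤ k)) =
      T.halfDisks (ε ∘ T.x) t := by
    funext i j
    unfold chordMatrix
    split_ifs with hij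
    · exact hR _
    · exact (T.halfDisks_eq_zero _ _ (not_lt.1 hij)).symm
  have hdeg : ∀ k, chordDeg μR k ≠ 0 → (ε.comp T.phiR) (FreeAlgebra.ι ℤ k) = 0 := by
    intro k hk
    rw [hR]
    by_contra h
    refine hk ?_
    rw [chordDeg, hhom _ _ h]
    ring
  -- `A * A = 0` over the right border gives both the augmentation equation and the inclusion of
  -- boundaries in cycles; exactness gives the other inclusion.
  refine ⟨⟨hdeg, map_differential_eq_zero fun k => ?_⟩, (isAcyclic_iff hRmat hhom).2 fun z =>
    ⟨hA.exact z, ?_⟩⟩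
  · have h := chordD_eq_neg_mul hdeg k
    rw [hRmat, hA.mul_self] at h
    rw [borderD, map_chordD]
    exact h.trans neg_zero
  · rintro ⟨y, rfl⟩
    rw [Matrix.vecMul_vecMul, hA.mul_self, Matrix.vecMul_zero]
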